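/- A 01-partition (jagged partition) of $n\ge 0$ is a finite sequence $(n_1,\dots,n_m)$ of non-negative integers with $n_1+\cdots+n_m=n$ whose last entry $n_m$ is non-zero (if $m\ge 1$) and which satisfies $n_i\ge n_{i+1}-1$ for $1\le i\le m-1$ and $n_i\ge n_{i+2}$ for $1\le i\le m-2$; the empty sequence is the only 01-partition of $0$. Let $j(n)$ be the number of 01-partitions of $n$, and write $(q^c;q^c)_\infty=\prod_{k\ge1}(1-q^{ck})$ and $(q)_\infty=(q;q)_\infty$. Then the following identities of formal power series in $q$ hold: $$\sum_{n\ge0} j(2n)q^n=\frac{(q^4;q^4)_\infty^5}{(q)_\infty^4(q^8;q^8)_\infty^2},\qquad \sum_{n\ge0} j(2n+1)q^n=2\,\frac{(q^2;q^2)_\infty^2(q^8;q^8)_\infty^2}{(q)_\infty^4(q^4;q^4)_\infty},$$ $$\sum_{n\ge0} j(3n)q^n=\frac{(q^2;q^2)_\infty^4(q^3;q^3)_\infty^6}{(q)_\infty^8(q^6;q^6)_\infty^3},\qquad \sum_{n\ge0} j(3n+1)q^n=2\,\frac{(q^2;q^2)_\infty^3(q^3;q^3)_\infty^3}{(q)_\infty^7},$$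 $$\sum_{n\ge0} j(3n+2)q^n=4\,\frac{(q^2;q^2)_\infty^2(q^6;q^6)_\infty^3}{(q)_\infty^6},\qquad \sum_{n\ge0} j(4n)q^n=\frac{(q^2;q^2)_\infty^{19}}{(q)_\infty^{14}(q^4;q^4)_\infty^6},$$ $$\sum_{n\ge0} j(4n+1)q^n=2\,\frac{(q^2;q^2)_\infty^{13}}{(q)_\infty^{12}(q^4;q^4)_\infty^2},\qquad \sum_{n\ge0} j(4n+2)q^n=4\,\frac{(q^2;q^2)_\infty^7(q^4;q^4)_\infty^2}{(q)_\infty^{10}},$$ $$\sum_{n\ge0} j(4n+3)q^n=8\,\frac{(q^2;q^2)_\infty(q^4;q^4)_\infty^6}{(q)_\infty^8}.$$ -/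

import Mathlib

open scoped PowerSeries PowerSeries.WithPiTopology

namespace JaggedPartition

/-- A 01-partition (jagged partition) of `n`: a finite sequence `(n₁, …, n_m)` of non-negative
integers with sum `n`, with last entry non-zero, such that `n_j ≥ n_{j+1} - 1` and
`n_j ≥ n_{j+2}` whenever these entries exist. The empty sequence is the 01-partition of `0`. -/
structure IsZeroOnePartition (n : ℕ) (l : List ℕ) : Prop where
  sum_eq : l.sum = n
  last_ne_zero : ∀ h : l ≠ [], l.getLast h ≠ 0
  le_succ : ∀ (i : ℕ) (hi : i + 1 < l.length), l[i + 1] ≤ l[i] + 1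
  le_two : ∀ (i : ℕ) (hi : i + 2 < l.length), l[i + 2] ≤ l[i]

/-- `j n` is the number of 01-partitions of `n`. -/
noncomputable def j (n : ℕ) : ℕ := {l : List ℕ | IsZeroOnePartition n l}.ncard

/-- The infinite `q`-Pochhammer symbol `(a; q)_∞ = ∏_{k ≥ 0} (1 - a q^k)`, as a product in the
ring of formal power series with the topology of coefficientwise convergence. -/
noncomputable def qPochhammerInf (a q : ℚ⟦X⟧) : ℚ⟦X⟧ := ∏' k : ℕ, (1 - a * q ^ k)

/-- `euler m` is `(q^m; q^m)_∞`, where `q` is the variable of the formal power series. -/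
noncomputable def euler (m : ℕ) : ℚ⟦X⟧ :=
  qPochhammerInf (PowerSeries.X ^ m) (PowerSeries.X ^ m)

/-- The generating function `∑_{n ≥ 0} j(r n + s) q^n`. -/
noncomputable def genFun (r s : ℕ) : ℚ⟦X⟧ := PowerSeries.mk fun n => (j (r * n + s) : ℚ)

theorem IsZeroOnePartition.length_le (l : List ℕ) :
    ∀ n, IsZeroOnePartition n l → l.length ≤ 2 * n := by
  induction hN : l.length using Nat.strong_induction_on generalizing l with
  | _ N ih =>
    intro n hl
    match l, hN, hl with
    | [], hN, _ => simp at hN; omega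
    | [a], hN, hl =>
      have h1 := hl.last_ne_zero (by simp)
      have h2 := hl.sum_eq
      simp at hN h1 h2
      omega
    | a :: b :: t, hN, hl =>
      have hs := hl.sum_eq
      simp at hN hs
      have ht : IsZeroOnePartition t.sum t := by
        refine ⟨rfl, fun h => ?_, fun i hi => ?_, fun i hi => ?_⟩
        · have := hl.last_ne_zero (by simp)
          rwa [List.getLast_cons (by simp), List.getLast_cons h] at this
        · exact hl.le_succ (i + 2) (by simp; omega)
        · exact hl.le_two (i + 2) (by simp; omega)
      have h1 := ih t.length (by omega) t rfl _ ht
      have h2 : 1 ≤ a + b := by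
        by_contra hc
        have ha : a = 0 := by omega
        have hb : b = 0 := by omega
        have key : ∀ i, ∀ hi : i < (a :: b :: t).length, (a :: b :: t)[i] = 0 := by
          intro i
          induction i using Nat.strong_induction_on with
          | _ i ihi =>
            intro hi
            match i, ihi, hi with
            | 0, _, _ => simpa using ha
            | 1, _, _ => simpa using hb
            | i + 2, ihi, hi =>
              have h3 := hl.le_two i hi
              have h4 := ihi i (by omega) (by omega)
              omega
        apply hl.last_ne_zero (by simp)
        rw [List.getLast_eq_getElem]
        exact key _ _
      omega

/-- The set counted by `j n` is finite, so `j n` is a genuine count. -/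
theorem finite_setOf_isZeroOnePartition (n : ℕ) :
    {l : List ℕ | IsZeroOnePartition n l}.Finite := by
  have h : (⋃ k ∈ Finset.range (2 * n + 1),
      {l : List ℕ | l.length = k ∧ ∀ x ∈ l, x ∈ Finset.range (n + 1)}).Finite := by
    refine Set.Finite.biUnion (Finset.finite_toSet _) fun k _ => ?_
    have := (List.finite_length_eq (Finset.range (n + 1)) k).image (List.map Subtype.val)
    refine this.subset ?_
    rintro l ⟨h1, h2⟩
    exact ⟨l.attachWith _ h2, by simpa using h1, by simp⟩
  refine h.subset fun l hl => ?_
  have h1 := IsZeroOnePartition.length_le l n hl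
  simp only [Set.mem_iUnion, Finset.mem_range]
  refine ⟨l.length, by omega, rfl, fun x hx => ?_⟩
  have := List.le_sum_of_mem hx
  have := hl.sum_eq
  omega

/-- The product defining `(q^m; q^m)_∞` converges for `m ≥ 1`. -/
theorem multipliable_euler (m : ℕ) (hm : 0 < m) :
    Multipliable fun k : ℕ => (1 - PowerSeries.X ^ m * (PowerSeries.X ^ m) ^ k : ℚ⟦X⟧) := by
  simp_rw [sub_eq_add_neg]
  apply PowerSeries.WithPiTopology.multipliable_one_add_of_tendsto_order_atTop_nhds_top
  refine ENat.tendsto_nhds_top_iff_natCast_lt.mpr fun n => Filter.eventually_atTop.mpr ⟨n, ?_⟩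
  intro k hk
  rw [PowerSeries.order_neg, ← pow_mul, ← pow_add, PowerSeries.order_X_pow]
  have : n < m + m * k := by nlinarith
  exact_mod_cast this

/-- `(q^m; q^m)_∞` has constant coefficient `1`, so it is invertible. -/
theorem constantCoeff_euler (m : ℕ) (hm : 0 < m) :
    PowerSeries.constantCoeff (euler m) = 1 := by
  unfold euler qPochhammerInf
  rw [(multipliable_euler m hm).map_tprod _
    (PowerSeries.WithPiTopology.continuous_constantCoeff ℚ)]
  simp [hm.ne']

end JaggedPartition

open JaggedPartition

namespace JaggedPartition

open PowerSeries Filter Topology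

/-! ### Infinite products over arithmetic progressions of exponents. -/

section ProgressionProduct

variable {K : Type*} [Field K] [TopologicalSpace K]

/-! Peeling maximal entries off the front of a 01-partition telescopes to a product formula: the
full generating function is 1/((q;q)_∞ (q;q²)_∞) = 1/φ(-q), where φ(-q) = ∑ (-1)^j q^{j²}
(`progProd_mul_progProd_mul_genFun`, `genFun_mul_phiNeg`). It remains to split 1/φ(-q) by exponents
modulo 2, 3 and 4.

The Jacobi triple product (`hasSum_tripleProduct`, a limit of the finite identity
`finite_tripleProduct`) turns theta series into products. Sorting the summation index by residue
gives φ(q) = φ(q⁴) + 2qψ(q⁸) and φ(-q) = φ(-q⁹) - 2qΩ(-q³). The denominator φ(-q) is then made a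
series in q^r: modulo 2, by φ(q)φ(-q) = φ(-q²)²; modulo 4, by a further factor φ(q²)² = φ(q⁴)² +
4q²ψ(q⁸)² (`phiPos_two_sq`); modulo 3, by multiplying over the cube roots of unity, which gives
φ(-q⁹)³ - 8q³Ω(-q³)³ = φ(-q³)⁴/φ(-q⁹) (`phiNeg_nine_cube`). In each case the numerator is a sum of
q^i times series in q^r, so the components can be read off (`genFun_eq_of_dissection`) and rewritten
through (q^m;q^m)_∞. -/

theorem multipliable_one_add_of_X_pow_dvd {f : ℕ → K⟦X⟧} (h : ∀ k, X ^ k ∣ f k) :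
    Multipliable fun k => 1 + f k := by
  apply PowerSeries.WithPiTopology.multipliable_one_add_of_tendsto_order_atTop_nhds_top
  refine ENat.tendsto_nhds_top_iff_natCast_lt.mpr fun n =>
    Filter.eventually_atTop.mpr ⟨n + 1, fun k hk => ?_⟩
  refine lt_of_lt_of_le ?_ (le_order (f k) k fun i hi => X_pow_dvd_iff.mp (h k) i (by exact_mod_cast hi))
  exact_mod_cast hk

/-- The product `∏_{k ≥ 0} (1 + c q^{a + m k})` over an arithmetic progression of exponents. -/
noncomputable def progProd (c : K) (a m : ℕ) : K⟦X⟧ :=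
  ∏' k : ℕ, (1 + C c * X ^ (a + m * k))

theorem multipliable_progProd (c : K) (a : ℕ) {m : ℕ} (hm : 0 < m) :
    Multipliable fun k : ℕ => (1 + C c * X ^ (a + m * k) : K⟦X⟧) :=
  multipliable_one_add_of_X_pow_dvd fun k =>
    Dvd.dvd.mul_left (pow_dvd_pow _ (by nlinarith)) _

theorem tendsto_progProd (c : K) (a : ℕ) {m : ℕ} (hm : 0 < m) :
    Tendsto (fun n => ∏ k ∈ Finset.range n, (1 + C c * X ^ (a + m * k) : K⟦X⟧)) atTop
      (𝓝 (progProd c a m)) :=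
  (multipliable_progProd c a hm).hasProd.tendsto_prod_nat

theorem continuous_expand {r : ℕ} (hr : r ≠ 0) : Continuous (expand r hr : K⟦X⟧ →ₐ[K] K⟦X⟧) := by
  rw [continuous_iff_continuousAt]
  intro f
  rw [ContinuousAt, PowerSeries.WithPiTopology.tendsto_iff_coeff_tendsto]
  intro d
  simp only [coeff_expand]
  split_ifs
  · exact (PowerSeries.WithPiTopology.continuous_coeff K _).continuousAt
  · exact tendsto_const_nhds

variable [IsTopologicalRing K] in
theorem continuous_rescale (ω : K) : Continuous (rescale ω : K⟦X⟧ →+* K⟦X⟧) := by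
  rw [continuous_iff_continuousAt]
  intro f
  rw [ContinuousAt, PowerSeries.WithPiTopology.tendsto_iff_coeff_tendsto]
  intro d
  simp only [coeff_rescale]
  exact ((PowerSeries.WithPiTopology.continuous_coeff K d).const_mul _).continuousAt

/-- Continuity moves the map inside the infinite product, so only its effect on a single monomial
has to be checked. This serves q ↦ q^r, q ↦ ωq and the change of coefficient field. -/
theorem map_progProd_of_continuous {L : Type*} [Field L] [TopologicalSpace L]
    [T2Space L] (φ : K⟦X⟧ →+* L⟦X⟧) (hφ : Continuous φ) {c : K} {d : L}
    {a m b n : ℕ} (hm : 0 < m) (h : ∀ k, φ (C c * X ^ (a + m * k)) = C d * X ^ (b + n * k)) :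
    φ (progProd c a m) = progProd d b n := by
  rw [progProd, (multipliable_progProd c a hm).map_tprod _ hφ, progProd]
  simp [h]

theorem map_progProd {L : Type*} [Field L] [TopologicalSpace L] [T2Space L]
    (φ : K →+* L) (hφ : Continuous φ) (c : K) (a : ℕ) {m : ℕ} (hm : 0 < m) :
    PowerSeries.map φ (progProd c a m) = progProd (φ c) a m := by
  refine map_progProd_of_continuous (PowerSeries.map φ) ?_ hm fun k => by simp
  rw [continuous_iff_continuousAt]
  intro f
  rw [ContinuousAt, PowerSeries.WithPiTopology.tendsto_iff_coeff_tendsto]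
  intro d
  simp only [coeff_map]
  exact (hφ.comp (PowerSeries.WithPiTopology.continuous_coeff K d)).continuousAt

variable [T2Space K]

theorem expand_progProd {r : ℕ} (hr : r ≠ 0) (c : K) (a : ℕ) {m : ℕ} (hm : 0 < m) :
    expand r hr (progProd c a m) = progProd c (r * a) (r * m) := by
  refine map_progProd_of_continuous (expand r hr : K⟦X⟧ →ₐ[K] K⟦X⟧).toRingHom
    (continuous_expand hr) hm fun k => ?_
  simp only [AlgHom.toRingHom_eq_coe, RingHom.coe_coe, map_mul, map_pow, expand_X, expand_C]
  ring

/-- The partial products converge, so any subsequence identifies the limit. The splittings below use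
lengths 2n and 3n, where the factors group into complete blocks. -/
theorem progProd_eq_of_tendsto {c : K} {a m : ℕ} (hm : 0 < m) {f : K⟦X⟧} {u : ℕ → ℕ}
    (hu : Tendsto u atTop atTop)
    (h : Tendsto (fun n => ∏ k ∈ Finset.range (u n), (1 + C c * X ^ (a + m * k) : K⟦X⟧)) atTop
      (𝓝 f)) : progProd c a m = f :=
  tendsto_nhds_unique ((tendsto_progProd c a hm).comp hu) h

variable [IsTopologicalRing K]

theorem progProd_split_two (c : K) (a : ℕ) {m : ℕ} (hm : 0 < m) :
    progProd c a m = progProd c a (2 * m) * progProd c (a + m) (2 * m) := by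
  have hm2 : 0 < 2 * m := by omega
  refine progProd_eq_of_tendsto hm (u := fun n => 2 * n)
    (tendsto_id.const_mul_atTop' (by norm_num)) ?_
  refine ((tendsto_progProd c a hm2).mul (tendsto_progProd c (a + m) hm2)).congr fun n => ?_
  induction n with
  | zero => simp
  | succ n ih =>
    rw [show 2 * (n + 1) = 2 * n + 1 + 1 by ring]
    simp only [Finset.prod_range_succ]
    rw [← ih, show a + m * (2 * n) = a + 2 * m * n by ring,
      show a + m * (2 * n + 1) = a + m + 2 * m * n by ring]
    ring

theorem progProd_split_three (c : K) (a : ℕ) {m : ℕ} (hm : 0 < m) :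
    progProd c a m = progProd c a (3 * m) * progProd c (a + m) (3 * m) *
      progProd c (a + 2 * m) (3 * m) := by
  have hm3 : 0 < 3 * m := by omega
  refine progProd_eq_of_tendsto hm (u := fun n => 3 * n)
    (tendsto_id.const_mul_atTop' (by norm_num)) ?_
  refine (((tendsto_progProd c a hm3).mul (tendsto_progProd c (a + m) hm3)).mul
    (tendsto_progProd c (a + 2 * m) hm3)).congr fun n => ?_
  induction n with
  | zero => simp
  | succ n ih =>
    rw [show 3 * (n + 1) = 3 * n + 1 + 1 + 1 by ring]
    simp only [Finset.prod_range_succ]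
    rw [← ih, show a + m * (3 * n) = a + 3 * m * n by ring,
      show a + m * (3 * n + 1) = a + m + 3 * m * n by ring,
      show a + m * (3 * n + 1 + 1) = a + 2 * m + 3 * m * n by ring]
    ring

theorem progProd_mul_neg (c : K) (a : ℕ) {m : ℕ} (hm : 0 < m) :
    progProd c a m * progProd (-c) a m = progProd (-c ^ 2) (2 * a) (2 * m) := by
  refine (progProd_eq_of_tendsto (by omega) tendsto_id ?_).symm
  refine ((tendsto_progProd c a hm).mul (tendsto_progProd (-c) a hm)).congr fun n => ?_
  rw [← Finset.prod_mul_distrib]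
  refine Finset.prod_congr rfl fun k _ => ?_
  simp only [map_neg, map_pow]
  ring

/-- The product of `1 + c ζ q^i` over the cube roots of unity `ζ` is `1 + c³ q^{3i}`. -/
theorem progProd_mul_cube_root {ω : K} (hω : 1 + ω + ω ^ 2 = 0) (c : K) (a : ℕ) {m : ℕ}
    (hm : 0 < m) :
    progProd c a m * progProd (c * ω) a m * progProd (c * ω ^ 2) a m =
      progProd (c ^ 3) (3 * a) (3 * m) := by
  refine (progProd_eq_of_tendsto (by omega) tendsto_id ?_).symm
  refine (((tendsto_progProd c a hm).mul (tendsto_progProd (c * ω) a hm)).mul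
    (tendsto_progProd (c * ω ^ 2) a hm)).congr fun n => ?_
  rw [← Finset.prod_mul_distrib, ← Finset.prod_mul_distrib]
  refine Finset.prod_congr rfl fun k _ => ?_
  have h : (1 + C ω + C ω ^ 2 : K⟦X⟧) = 0 := by
    rw [← map_pow, ← map_one C, ← map_add, ← map_add, hω, map_zero]
  have h3 : (C ω ^ 3 : K⟦X⟧) = 1 := by linear_combination (C ω - 1) * h
  simp only [map_mul, map_pow]
  rw [show 3 * a + 3 * m * k = (a + m * k) * 3 by ring, pow_mul]
  generalize (X : K⟦X⟧) ^ (a + m * k) = x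
  linear_combination (C c * x + C c ^ 2 * x ^ 2 * C ω) * h + (C c ^ 3 * x ^ 3) * h3

theorem progProd_zero (c : K) {m : ℕ} (hm : 0 < m) :
    progProd c 0 m = C (1 + c) * progProd c m m := by
  refine progProd_eq_of_tendsto hm (tendsto_add_atTop_nat 1) ?_
  refine ((tendsto_progProd c m hm).const_mul _).congr fun n => ?_
  rw [Finset.prod_range_succ', mul_comm]
  congr 1
  · refine Finset.prod_congr rfl fun k _ => ?_
    ring
  · simp

theorem rescale_progProd {ω : K} (c : K) (a : ℕ) {m : ℕ} (hm : 0 < m) (hω : ω ^ m = 1) :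
    rescale ω (progProd c a m) = progProd (c * ω ^ a) a m := by
  refine map_progProd_of_continuous (rescale ω) (continuous_rescale ω) hm fun k => ?_
  have : (C ω : K⟦X⟧) ^ m = 1 := by rw [← map_pow, hω, map_one]
  have hC : rescale ω (C c) = C c := by
    ext n
    rw [coeff_rescale, coeff_C]
    split_ifs with h <;> simp [h]
  simp only [map_mul, map_pow, rescale_X, hC, mul_pow, pow_add, pow_mul, this, one_pow]
  ring

/-- For `3 ∤ m` and a primitive cube root of unity `ω`, the product of the images of
`(q^m; q^m)_∞` under `q ↦ ω^i q`. -/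
theorem prod_rescale_cube_root_progProd {ω : K} (hω : 1 + ω + ω ^ 2 = 0) {m : ℕ} (hm : 0 < m)
    (hm3 : ω ^ m = ω ∨ ω ^ m = ω ^ 2) :
    progProd (-1) m m * rescale ω (progProd (-1) m m) * rescale (ω ^ 2) (progProd (-1) m m) *
      progProd (-1) (9 * m) (9 * m) = progProd (-1) (3 * m) (3 * m) ^ 4 := by
  have h3 : ω ^ 3 = 1 := by linear_combination (ω - 1) * hω
  have hp : 0 < 3 * m := by omega
  have e1 : ω ^ (3 * m) = 1 := by rw [pow_mul, h3, one_pow]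
  have e2 : (ω ^ 2) ^ (3 * m) = 1 := by rw [← pow_mul, mul_comm 2, pow_mul, e1, one_pow]
  have key : progProd (-1 : K) (3 * m) (3 * m) = progProd (-1) (3 * m) (9 * m) *
      progProd (-1) (6 * m) (9 * m) * progProd (-1) (9 * m) (9 * m) := by
    rw [progProd_split_three _ _ hp, show 3 * m + 3 * m = 6 * m by ring,
      show 3 * m + 2 * (3 * m) = 9 * m by ring, show 3 * (3 * m) = 9 * m by ring]
  have c1 := progProd_mul_cube_root hω (-1) m hp
  have c2 := progProd_mul_cube_root hω (-1) (2 * m) hp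
  have hneg : (-1 : K) ^ 3 = -1 := by ring
  rw [hneg, show 3 * (3 * m) = 9 * m by ring] at c1
  rw [hneg, show 3 * (3 * m) = 9 * m by ring, show 3 * (2 * m) = 6 * m by ring] at c2
  -- The factor with exponents divisible by 3m is fixed by the rescalings and contributes a cube.
  -- Each of the other two is multiplied by its conjugates through `c1`, `c2`; together with
  -- (q^{9m};q^{9m})_∞ these reassemble into one more copy by `key`. The two cases for ω^m only
  -- permute the roots.
  have s : progProd (-1 : K) m m = progProd (-1) m (3 * m) * progProd (-1) (2 * m) (3 * m) *
      progProd (-1) (3 * m) (3 * m) := by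
    rw [progProd_split_three _ _ hm, show m + m = 2 * m by ring, show m + 2 * m = 3 * m by ring]
  have e4 : ω ^ 4 = ω := by linear_combination ω * h3
  rw [s]
  simp only [map_mul, rescale_progProd _ _ hp e1, rescale_progProd _ _ hp e2, e1, e2, mul_one]
  set E := progProd (-1 : K) (3 * m) (3 * m)
  set F := progProd (-1 : K) (9 * m) (9 * m)
  set U := progProd (-1 : K) (3 * m) (9 * m)
  rcases hm3 with hh | hh
  · have a2 : ω ^ (2 * m) = ω ^ 2 := by rw [mul_comm, pow_mul, hh]
    have b1 : (ω ^ 2) ^ m = ω ^ 2 := by rw [← pow_mul, a2]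
    have b2 : (ω ^ 2) ^ (2 * m) = ω := by rw [mul_comm, pow_mul, b1, ← pow_mul, e4]
    rw [hh, a2, b1, b2]
    linear_combination E ^ 3 * F * (progProd (-1) (2 * m) (3 * m) *
      progProd (-1 * ω) (2 * m) (3 * m) * progProd (-1 * ω ^ 2) (2 * m) (3 * m)) * c1 +
      E ^ 3 * F * U * c2 - E ^ 3 * key
  · have a2 : ω ^ (2 * m) = ω := by rw [mul_comm, pow_mul, hh, ← pow_mul, e4]
    have b1 : (ω ^ 2) ^ m = ω := by rw [← pow_mul, a2]
    have b2 : (ω ^ 2) ^ (2 * m) = ω ^ 2 := by rw [mul_comm 2 m, pow_mul, b1]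
    rw [hh, a2, b1, b2]
    linear_combination E ^ 3 * F * (progProd (-1) (2 * m) (3 * m) *
      progProd (-1 * ω) (2 * m) (3 * m) * progProd (-1 * ω ^ 2) (2 * m) (3 * m)) * c1 +
      E ^ 3 * F * U * c2 - E ^ 3 * key

end ProgressionProduct

/-! ### A finite form of the triple product. -/

section FiniteTripleProduct

variable {R : Type*} [CommRing R] {p : R} {r : ℕ → R}

open Finset in
-- A q-Pascal rule: for i + k = N + 1, write 1 - p^{i+k} = (1 - p^i) + p^i(1 - p^k); each bracket
-- lowers the index of one factor `r`.
theorem one_sub_pow_mul_sum_antidiagonal (hr : ∀ i, (1 - p ^ (i + 1)) * r (i + 1) = r i)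
    (s : ℕ → R) (N : ℕ) :
    (1 - p ^ (N + 1)) * ∑ x ∈ antidiagonal (N + 1), r x.1 * r x.2 * s x.2 =
      ∑ x ∈ antidiagonal N, r x.1 * r x.2 * s x.2 +
        ∑ x ∈ antidiagonal N, r x.1 * r x.2 * (p ^ x.1 * s (x.2 + 1)) := by
  have h : (1 - p ^ (N + 1)) * ∑ x ∈ antidiagonal (N + 1), r x.1 * r x.2 * s x.2 =
      ∑ x ∈ antidiagonal (N + 1), (1 - p ^ x.1) * r x.1 * r x.2 * s x.2 +
      ∑ x ∈ antidiagonal (N + 1), (1 - p ^ x.2) * r x.2 * (r x.1 * (p ^ x.1 * s x.2)) := by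
    rw [mul_sum, ← sum_add_distrib]
    refine sum_congr rfl fun x hx => ?_
    rw [← mem_antidiagonal.mp hx, pow_add]
    ring
  rw [h, Nat.sum_antidiagonal_succ, Nat.sum_antidiagonal_succ' (n := N)]
  simp only [hr, pow_zero, sub_self, zero_mul, zero_add]
  congr 1
  exact sum_congr rfl fun x _ => by ring

open Finset in
-- The mirror rule, from 1 - p^{i+k} = (1 - p^k) + p^k(1 - p^i).
theorem one_sub_pow_mul_sum_antidiagonal' (hr : ∀ i, (1 - p ^ (i + 1)) * r (i + 1) = r i)
    (s : ℕ → R) (N : ℕ) :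
    (1 - p ^ (N + 1)) * ∑ x ∈ antidiagonal (N + 1), r x.1 * r x.2 * s x.2 =
      ∑ x ∈ antidiagonal N, r x.1 * r x.2 * s (x.2 + 1) +
        ∑ x ∈ antidiagonal N, r x.1 * r x.2 * (p ^ x.2 * s x.2) := by
  have h : (1 - p ^ (N + 1)) * ∑ x ∈ antidiagonal (N + 1), r x.1 * r x.2 * s x.2 =
      ∑ x ∈ antidiagonal (N + 1), (1 - p ^ x.2) * r x.2 * (r x.1 * s x.2) +
      ∑ x ∈ antidiagonal (N + 1), (1 - p ^ x.1) * r x.1 * (r x.2 * (p ^ x.2 * s x.2)) := by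
    rw [mul_sum, ← sum_add_distrib]
    refine sum_congr rfl fun x hx => ?_
    rw [← mem_antidiagonal.mp hx, pow_add]
    ring
  rw [h, Nat.sum_antidiagonal_succ' (n := N), Nat.sum_antidiagonal_succ]
  simp only [hr, pow_zero, sub_self, zero_mul, zero_add]
  congr 1 <;> exact sum_congr rfl fun x _ => by ring

open Finset in
/-- A finite form of the Jacobi triple product identity. The sequence `r` plays the role of
`1 / (p; p)_i`, and `t` that of `a ^ (j (j + 1) / 2) * b ^ (j (j - 1) / 2)` with `a * b = p`. -/
theorem finite_tripleProduct {a b : R} {t : ℤ → R} (hr0 : r 0 = 1)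
    (hr : ∀ i, (1 - p ^ (i + 1)) * r (i + 1) = r i) (ht0 : t 0 = 1)
    (ha : ∀ i k m n : ℕ, i + k = m + n → p ^ i * t (k + 1 - n) = a * p ^ m * t (k - n))
    (hb : ∀ i k m n : ℕ, i + k = m + n → p ^ k * t (k - (n + 1)) = b * p ^ n * t (k - n))
    (m n : ℕ) :
    (∏ k ∈ range m, (1 + a * p ^ k)) * ∏ k ∈ range n, (1 + b * p ^ k) =
      (∏ k ∈ range (m + n), (1 - p ^ (k + 1))) *
        ∑ x ∈ antidiagonal (m + n), r x.1 * r x.2 * t (x.2 - n) := by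
  -- The first Pascal rule adjoins a factor 1 + a p^m. In the base case m = 0 the mirror rule
  -- adjoins 1 + b p^n, which also shifts the centre of `t` by one.
  induction m with
  | zero =>
    induction n with
    | zero => simp [hr0, ht0]
    | succ n ih =>
      have h := one_sub_pow_mul_sum_antidiagonal' hr (fun k => t (k - ((n + 1 : ℕ) : ℤ))) (0 + n)
      rw [prod_range_succ _ n, ← mul_assoc, ih, ← add_assoc, prod_range_succ, mul_assoc _ (1 - _),
        h, mul_assoc, ← sum_add_distrib, sum_mul]
      congr 1
      refine sum_congr rfl fun x hx => ?_
      have h2 := hb x.1 x.2 0 n (mem_antidiagonal.mp hx)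
      push_cast
      rw [h2, add_sub_add_right_eq_sub]
      ring
  | succ m ih =>
    have h := one_sub_pow_mul_sum_antidiagonal hr (fun k => t (k - (n : ℤ))) (m + n)
    rw [prod_range_succ _ m, mul_right_comm, ih, add_right_comm, prod_range_succ _ (m + n),
      mul_assoc _ (1 - _), h, mul_assoc, ← sum_add_distrib, sum_mul]
    congr 1
    refine sum_congr rfl fun x hx => ?_
    have h2 := ha x.1 x.2 m n (mem_antidiagonal.mp hx)
    push_cast
    rw [h2]
    ring

end FiniteTripleProduct

/-! ### The Jacobi triple product as a limit. -/

section TripleProduct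

variable {K : Type*} [Field K] [TopologicalSpace K]

theorem multipliable_inv_one_sub {M : ℕ} (hM : 0 < M) :
    Multipliable fun k : ℕ => ((1 - (X ^ M) ^ (k + 1))⁻¹ : K⟦X⟧) := by
  have h : ∀ k : ℕ, ((1 - (X ^ M) ^ (k + 1))⁻¹ : K⟦X⟧) =
      1 + (X ^ M) ^ (k + 1) * (1 - (X ^ M) ^ (k + 1))⁻¹ := fun k => by
    have : (1 - (X ^ M) ^ (k + 1) : K⟦X⟧) * (1 - (X ^ M) ^ (k + 1))⁻¹ = 1 :=
      PowerSeries.mul_inv_cancel _ (by simp [hM.ne'])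
    linear_combination this
  rw [funext h]
  refine multipliable_one_add_of_X_pow_dvd fun k => Dvd.dvd.mul_right ?_ _
  rw [← pow_mul]
  exact pow_dvd_pow _ (by nlinarith)

variable [IsTopologicalRing K] [T2Space K]

/-- **Jacobi triple product identity**, for the series `∑_j z^j q^{A j² + B j}`. -/
theorem hasSum_tripleProduct {A B : ℕ} (hA : 0 < A) (hB : B ≤ A) {z : K} (hz : z ≠ 0) {e : ℤ → ℕ}
    (he : ∀ j, (e j : ℤ) = A * j ^ 2 + B * j) :
    HasSum (fun j : ℤ => (C (z ^ j) * X ^ e j : K⟦X⟧))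
      (progProd z (A + B) (2 * A) * progProd z⁻¹ (A - B) (2 * A) *
        progProd (-1) (2 * A) (2 * A)) := by
  have hM : 0 < 2 * A := by omega
  set p : K⟦X⟧ := X ^ (2 * A) with hp
  set t : ℤ → K⟦X⟧ := fun j => C (z ^ j) * X ^ e j with ht
  set r : ℕ → K⟦X⟧ := fun n => ∏ k ∈ Finset.range n, (1 - p ^ (k + 1))⁻¹ with hrdef
  have hinv : ∀ k, (1 - p ^ (k + 1)) * (1 - p ^ (k + 1))⁻¹ = 1 := fun k =>
    PowerSeries.mul_inv_cancel _ (by simp [hp, hA.ne'])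
  set D : ℕ → K⟦X⟧ := fun n => ∏ k ∈ Finset.range n, (1 - p ^ (k + 1)) with hD
  set Di := progProd (-1 : K) (2 * A) (2 * A) with hDi
  obtain ⟨Ri, hRi⟩ := multipliable_inv_one_sub (K := K) hM
  have hr : Tendsto r atTop (𝓝 Ri) := hRi.tendsto_prod_nat
  have hDt : Tendsto D atTop (𝓝 Di) := by
    refine (tendsto_progProd (-1) (2 * A) hM).congr fun n => Finset.prod_congr rfl fun k _ => ?_
    rw [hp, ← pow_mul]
    simp only [map_neg, map_one]
    ring
  have hDR : Di * Ri = 1 := by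
    refine tendsto_nhds_unique (hDt.mul hr) (tendsto_const_nhds.congr fun n => ?_)
    rw [hD, hrdef, ← Finset.prod_mul_distrib]
    simp [hinv]
  -- The finite identity with m = n, a = z q^{A+B}, b = z⁻¹ q^{A-B} and ab = p = q^{2A}, reindexed
  -- by the signed distance j from the middle.
  have fin : ∀ n : ℕ, (∏ k ∈ Finset.range n, (1 + C z * X ^ (A + B + 2 * A * k))) *
      (∏ k ∈ Finset.range n, (1 + C z⁻¹ * X ^ (A - B + 2 * A * k))) =
      ∑ j ∈ Finset.Icc (-n : ℤ) n, D (n + n) * r (n - j).toNat * r (n + j).toNat * t j := by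
    intro n
    have h := finite_tripleProduct (p := p) (r := r) (a := C z * X ^ (A + B))
      (b := C z⁻¹ * X ^ (A - B)) (t := t) (by simp [hrdef])
      (fun i => by
        simp only [hrdef, Finset.prod_range_succ _ i]
        rw [mul_left_comm, hinv, mul_one])
      (by
        have : e 0 = 0 := by have := he 0; simpa using this
        simp [ht, this])
      (fun i k m n hik => by
        have hexp : 2 * A * i + e (k + 1 - n) = A + B + 2 * A * m + e (k - n) := by
          zify
          have hik' : (i : ℤ) = m + n - k := by omega
          rw [he, he, hik']
          ring
        simp only [ht, hp]
        rw [show (k + 1 - n : ℤ) = (k - n) + 1 by ring] at hexp ⊢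
        rw [zpow_add_one₀ hz, ← pow_mul, map_mul]
        linear_combination C (z ^ (k - n : ℤ)) * C z * congrArg (fun i => (X : K⟦X⟧) ^ i) hexp)
      (fun i k m n hik => by
        have hexp : 2 * A * k + e (k - (n + 1)) = A - B + 2 * A * n + e (k - n) := by
          zify [hB]
          rw [he, he]
          ring
        simp only [ht, hp]
        rw [show (k - (n + 1) : ℤ) = (k - n) - 1 by ring] at hexp ⊢
        rw [zpow_sub_one₀ hz, ← pow_mul, map_mul]
        linear_combination C (z ^ (k - n : ℤ)) * C z⁻¹ * congrArg (fun i => (X : K⟦X⟧) ^ i) hexp)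
      n n
    have e1 : ∀ (c : K) (a : ℕ), ∏ k ∈ Finset.range n, (1 + C c * X ^ (a + 2 * A * k) : K⟦X⟧) =
        ∏ k ∈ Finset.range n, (1 + C c * X ^ a * p ^ k) := fun c a =>
      Finset.prod_congr rfl fun k _ => by rw [hp, pow_add, pow_mul, mul_assoc]
    rw [e1, e1, h, Finset.mul_sum]
    refine Finset.sum_nbij' (fun x => (x.2 : ℤ) - n) (fun j => ((n - j).toNat, (n + j).toNat))
      ?_ ?_ ?_ ?_ ?_
    · intro x hx
      have := Finset.HasAntidiagonal.mem_antidiagonal.mp hx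
      rw [Finset.mem_Icc]
      omega
    · intro j hj
      have := Finset.mem_Icc.mp hj
      rw [Finset.HasAntidiagonal.mem_antidiagonal]
      omega
    · intro x hx
      have := Finset.HasAntidiagonal.mem_antidiagonal.mp hx
      ext <;> simp only <;> omega
    · intro j hj
      have := Finset.mem_Icc.mp hj
      simp only
      omega
    · intro x hx
      have := Finset.HasAntidiagonal.mem_antidiagonal.mp hx
      rw [show ((n : ℤ) - (x.2 - n)).toNat = x.1 by omega,
        show ((n : ℤ) + (x.2 - n)).toNat = x.2 by omega]
      simp only [hD, mul_assoc]
  rw [PowerSeries.WithPiTopology.hasSum_iff_hasSum_coeff]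
  intro d
  -- The window reaches d + 1 rather than d because for B = A the exponent A j(j+1) vanishes at j =
  -- -1, which matters when d = 0.
  have hlarge : ∀ j : ℤ, j ∉ Finset.Icc (-(d + 1 : ℕ) : ℤ) (d + 1 : ℕ) → d < e j := by
    intro j hj
    rw [Finset.mem_Icc, not_and_or] at hj
    have hj2 := he j
    zify
    rw [hj2]
    push_cast at hj
    have hA' : (1 : ℤ) ≤ A := by exact_mod_cast hA
    have hB' : (B : ℤ) ≤ A := by exact_mod_cast hB
    have hB0 : (0 : ℤ) ≤ B := by positivity
    rcases hj with hj | hj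
    · have : (d : ℤ) + 1 < -j := by omega
      nlinarith [mul_nonneg (sub_nonneg.mpr hB') (show 0 ≤ -j by omega),
        mul_nonneg (sub_nonneg.mpr hA')
          (mul_nonneg (show 0 ≤ -j by omega) (show 0 ≤ -j - 1 by omega))]
    · nlinarith [mul_nonneg hB0 (show 0 ≤ j by omega),
        mul_nonneg (sub_nonneg.mpr hA') (sq_nonneg j)]
  have hzero : ∀ (f : K⟦X⟧) (j : ℤ), j ∉ Finset.Icc (-(d + 1 : ℕ) : ℤ) (d + 1 : ℕ) →
      coeff d (f * t j) = 0 := by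
    intro f j hj
    have : X ^ (e j) ∣ f * t j := Dvd.dvd.mul_left (Dvd.dvd.mul_left dvd_rfl _) _
    exact X_pow_dvd_iff.mp this d (hlarge j hj)
  have hsum := hasSum_sum_of_ne_finset_zero (f := fun j => coeff d (t j))
    (L := SummationFilter.unconditional ℤ)
    (s := Finset.Icc (-(d + 1 : ℕ) : ℤ) (d + 1 : ℕ)) (fun j hj => by simpa using hzero 1 j hj)
  convert hsum using 1
  have hN : Tendsto (fun n : ℕ => n + n) atTop atTop :=
    tendsto_atTop_mono (fun n => Nat.le_add_left n n) tendsto_id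
  -- With the window fixed, the limit passes through a finite sum. The spare factor `Di` makes each
  -- weight tend to Di·Di·Ri·Ri = 1.
  have lim1 : Tendsto (fun n : ℕ => coeff d (Di *
      ∑ j ∈ Finset.Icc (-(d + 1 : ℕ) : ℤ) (d + 1 : ℕ),
        D (n + n) * r (n - j).toNat * r (n + j).toNat * t j)) atTop
      (𝓝 (coeff d (Di * ∑ j ∈ Finset.Icc (-(d + 1 : ℕ) : ℤ) (d + 1 : ℕ), Di * Ri * Ri * t j))) := by
    refine ((PowerSeries.WithPiTopology.continuous_coeff K d).tendsto _).comp ?_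
    refine Tendsto.const_mul _ (tendsto_finsetSum _ fun j _ => Tendsto.mul_const _ ?_)
    refine ((hDt.comp hN).mul (hr.comp ?_)).mul (hr.comp ?_)
    · exact tendsto_atTop_mono (f := fun n : ℕ => n - j.toNat) (fun n => by omega)
        (tendsto_sub_atTop_nat _)
    · exact tendsto_atTop_mono (f := fun n : ℕ => n - (-j).toNat) (fun n => by omega)
        (tendsto_sub_atTop_nat _)
  have lim2 := ((PowerSeries.WithPiTopology.continuous_coeff K d).tendsto _).comp
    (((tendsto_progProd z (A + B) hM).mul (tendsto_progProd z⁻¹ (A - B) hM)).const_mul Di)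
  have heq := tendsto_nhds_unique lim2 (lim1.congr' ?_)
  · rw [mul_comm, heq]
    simp_rw [← map_sum, mul_assoc, ← Finset.mul_sum]
    congr 1
    linear_combination (∑ j ∈ Finset.Icc (-(d + 1 : ℕ) : ℤ) (d + 1 : ℕ), t j) * (Di * Ri + 1) * hDR
  · filter_upwards [eventually_ge_atTop (d + 1)] with n hn
    simp only [Function.comp]
    rw [fin n, Finset.mul_sum, Finset.mul_sum, map_sum, map_sum]
    refine Finset.sum_subset (Finset.Icc_subset_Icc (by omega) (by omega)) fun j _ hj => ?_
    rw [← mul_assoc]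
    exact hzero _ j hj

end TripleProduct

/-! ### The generating function of 01-partitions. -/

section Counting

/-- `JaggedAfter a b l` says that the entries of `l` satisfy the inequalities of a 01-partition
when `l` is preceded by the entries `a`, `b` (without any condition on `a` and `b` themselves). -/
def JaggedAfter : ℕ → ℕ → List ℕ → Prop
  | _, _, [] => True
  | a, b, x :: t => x ≤ a ∧ x ≤ b + 1 ∧ JaggedAfter b x t

/-- The 01-partitions of `n` that may follow the entries `a`, `b`. -/
def boundedPartitions (a b n : ℕ) : Set (List ℕ) :=
  {l | JaggedAfter a b l ∧ l.sum = n ∧ ∀ h : l ≠ [], l.getLast h ≠ 0}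

theorem jaggedAfter_iff (l : List ℕ) : ∀ a b : ℕ, JaggedAfter a b l ↔
    (∀ (i : ℕ) (hi : i + 1 < l.length), l[i + 1] ≤ l[i] + 1) ∧
    (∀ (i : ℕ) (hi : i + 2 < l.length), l[i + 2] ≤ l[i]) ∧
    (∀ h : 0 < l.length, l[0] ≤ a ∧ l[0] ≤ b + 1) ∧ (∀ h : 1 < l.length, l[1] ≤ b) := by
  induction l with
  | nil => simp [JaggedAfter]
  | cons x t ih =>
    intro a b
    simp only [JaggedAfter, ih]
    constructor
    · rintro ⟨h1, h2, h3, h4, h5, h6⟩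
      refine ⟨fun i hi => ?_, fun i hi => ?_, fun _ => ⟨h1, h2⟩, fun h => ?_⟩
      · rcases i with _ | i
        · exact (h5 (by simpa using hi)).2
        · exact h3 i (by simpa using hi)
      · rcases i with _ | i
        · exact h6 (by simp at hi; omega)
        · exact h4 i (by simp at hi; omega)
      · exact (h5 (by simpa using h)).1
    · rintro ⟨h1, h2, h3, h4⟩
      refine ⟨(h3 (by simp)).1, (h3 (by simp)).2, fun i hi => ?_, fun i hi => ?_, fun h => ⟨?_, ?_⟩,
        fun h => ?_⟩
      · exact h1 (i + 1) (by simpa using hi)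
      · exact h2 (i + 1) (by simp; omega)
      · exact h4 (by simpa using h)
      · exact h1 0 (by simpa using h)
      · exact h2 0 (by simp; omega)

theorem mem_boundedPartitions {a b n : ℕ} {l : List ℕ} : l ∈ boundedPartitions a b n ↔
    IsZeroOnePartition n l ∧
      (∀ h : 0 < l.length, l[0] ≤ a ∧ l[0] ≤ b + 1) ∧ (∀ h : 1 < l.length, l[1] ≤ b) := by
  simp only [boundedPartitions, Set.mem_ofPred_eq, jaggedAfter_iff]
  constructor
  · rintro ⟨⟨h1, h2, h3, h4⟩, h5, h6⟩
    exact ⟨⟨h5, h6, h1, h2⟩, h3, h4⟩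
  · rintro ⟨⟨h5, h6, h1, h2⟩, h3, h4⟩
    exact ⟨⟨h1, h2, h3, h4⟩, h5, h6⟩

theorem finite_boundedPartitions (a b n : ℕ) : (boundedPartitions a b n).Finite :=
  (finite_setOf_isZeroOnePartition n).subset fun _ hl => (mem_boundedPartitions.mp hl).1

/-- The generating function of the 01-partitions that may follow the entries `a`, `b`. -/
noncomputable def boundedGenFun (a b : ℕ) : ℚ⟦X⟧ :=
  PowerSeries.mk fun n => ((boundedPartitions a b n).ncard : ℚ)

/-- No entry exceeds the sum n, so a bound a ≥ n imposes nothing. -/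
theorem boundedPartitions_eq_of_le {a n : ℕ} (h : n ≤ a) :
    boundedPartitions a a n = {l | IsZeroOnePartition n l} := by
  ext l
  rw [mem_boundedPartitions]
  refine ⟨fun h => h.1, fun hl => ⟨hl, ?_⟩⟩
  have : ∀ (i : ℕ) (hi : i < l.length), l[i] ≤ n := fun i hi =>
    hl.sum_eq ▸ List.le_sum_of_mem (List.getElem_mem hi)
  exact ⟨fun h' => ⟨(this 0 h').trans h, (this 0 h').trans (by omega)⟩,
    fun h' => (this 1 h').trans h⟩

/-- After two zeros every entry is forced to be zero, and the condition on the last entry then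
leaves only the empty list. -/
theorem boundedPartitions_zero (n : ℕ) :
    boundedPartitions 0 0 n = if n = 0 then {[]} else ∅ := by
  have key : ∀ l : List ℕ, JaggedAfter 0 0 l → ∀ x ∈ l, x = 0 := by
    intro l
    induction l with
    | nil => simp
    | cons x t ih =>
      rintro ⟨h1, -, h3⟩
      obtain rfl : x = 0 := by omega
      simpa using ih h3
  have hnil : ∀ l ∈ boundedPartitions 0 0 n, l = [] := by
    rintro l ⟨h1, -, h3⟩
    by_contra hl
    exact h3 hl (key l h1 _ (List.getLast_mem hl))
  ext l
  split_ifs with hn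
  · refine ⟨hnil l, ?_⟩
    rintro rfl
    exact ⟨trivial, by simp [hn], by simp⟩
  · simp only [Set.mem_empty_iff_false, iff_false]
    intro h
    have h2 := h.2.1
    rw [hnil l h] at h2
    exact hn (by simpa using h2.symm)

theorem boundedGenFun_zero : boundedGenFun 0 0 = 1 := by
  ext n
  rw [boundedGenFun, coeff_mk, boundedPartitions_zero, coeff_one]
  split_ifs <;> simp

/-- If the lists following `a`, `b` split into those following another pair of entries and the ones obtained by
prepending a fixed prefix `u` of weight `w`, the generating functions satisfy `(1 - q^w) f = g`. -/
theorem one_sub_X_pow_mul_boundedGenFun {a b a' b' w : ℕ} {u : List ℕ}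
    (h : ∀ n l, l ∈ boundedPartitions a b n ↔ l ∈ boundedPartitions a' b' n ∨
      ∃ t k, t ∈ boundedPartitions a b k ∧ k + w = n ∧ l = u ++ t)
    (hdisj : ∀ n t, u ++ t ∉ boundedPartitions a' b' n) :
    (1 - X ^ w) * boundedGenFun a b = boundedGenFun a' b' := by
  ext n
  rw [sub_mul, one_mul, map_sub, coeff_X_pow_mul', sub_eq_iff_eq_add]
  simp only [boundedGenFun, coeff_mk]
  split_ifs with hn
  · have hset : boundedPartitions a b n =
        boundedPartitions a' b' n ∪ (u ++ ·) '' boundedPartitions a b (n - w) := by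
      ext l
      rw [h, Set.mem_union, Set.mem_image]
      refine or_congr_right ⟨?_, ?_⟩
      · rintro ⟨t, k, ht, hk, rfl⟩
        exact ⟨t, by rwa [← hk, Nat.add_sub_cancel], rfl⟩
      · rintro ⟨t, ht, rfl⟩
        exact ⟨t, n - w, ht, by omega, rfl⟩
    rw [hset, Set.ncard_union_eq ?_ (finite_boundedPartitions _ _ _)
      ((finite_boundedPartitions _ _ _).image _),
      Set.ncard_image_of_injective _ (List.append_right_injective u)]
    · push_cast
      rfl
    · rw [Set.disjoint_left]
      rintro _ hl ⟨t, -, rfl⟩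
      exact hdisj n t hl
  · have hset : boundedPartitions a b n = boundedPartitions a' b' n := by
      ext l
      rw [h, or_iff_left]
      rintro ⟨t, k, -, hk, -⟩
      omega
    rw [hset, add_zero]

/-- A first entry equal to the maximum r + 1 can be removed, and the rest again follows the pair (r
+ 1, r + 1). Otherwise the first entry is at most r. -/
theorem one_sub_mul_boundedGenFun_even (r : ℕ) :
    (1 - X ^ (r + 1)) * boundedGenFun (r + 1) (r + 1) = boundedGenFun r (r + 1) := by
  refine one_sub_X_pow_mul_boundedGenFun (u := [r + 1]) (fun n l => ?_) ?_
  · constructor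
    · rcases l with _ | ⟨x, t⟩
      · rintro ⟨-, h⟩
        exact Or.inl ⟨trivial, h⟩
      · rintro ⟨⟨h1, h2, h3⟩, h4, h5⟩
        rcases Nat.lt_or_ge r x with hx | hx
        · obtain rfl : x = r + 1 := by omega
          refine Or.inr ⟨t, t.sum, ⟨h3, rfl, fun h => ?_⟩, ?_, rfl⟩
          · have := h5 (by simp)
            rwa [List.getLast_cons h] at this
          · rw [← h4, List.sum_cons, add_comm]
        · exact Or.inl ⟨⟨hx, h2, h3⟩, h4, h5⟩
    · rintro (h | ⟨t, k, ⟨h1, h2, h3⟩, hk, rfl⟩)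
      · rcases l with _ | ⟨x, t⟩
        · exact ⟨trivial, h.2⟩
        · obtain ⟨⟨h1, h2, h3⟩, h⟩ := h
          exact ⟨⟨by omega, h2, h3⟩, h⟩
      · refine ⟨⟨le_rfl, by omega, h1⟩, ?_, fun h => ?_⟩
        · simp [h2, ← hk, add_comm]
        · rcases t with _ | ⟨y, t⟩
          · simp
          · simpa using h3 (by simp)
  · rintro n t ⟨⟨h1, -⟩, -⟩
    omega

/-- Here the second entry decides. If it is r + 1, the first must be r, and removing both restores
the pair (r, r + 1). If not, the list already follows (r, r). -/
theorem one_sub_mul_boundedGenFun_odd (r : ℕ) :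
    (1 - X ^ (2 * r + 1)) * boundedGenFun r (r + 1) = boundedGenFun r r := by
  refine one_sub_X_pow_mul_boundedGenFun (u := [r, r + 1]) (fun n l => ?_) ?_
  · constructor
    · rcases l with _ | ⟨x, _ | ⟨y, t⟩⟩
      · rintro ⟨-, h⟩
        exact Or.inl ⟨trivial, h⟩
      · rintro ⟨⟨h1, h2, h3⟩, h⟩
        exact Or.inl ⟨⟨h1, by omega, h3⟩, h⟩
      · rintro ⟨⟨h1, h2, h3, h4, h6⟩, h7, h5⟩
        rcases Nat.lt_or_ge r y with hy | hy
        · obtain rfl : y = r + 1 := by omega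
          obtain rfl : x = r := by omega
          refine Or.inr ⟨t, t.sum, ⟨h6, rfl, fun h => ?_⟩, ?_, rfl⟩
          · have := h5 (by simp)
            rwa [List.getLast_cons (by simp), List.getLast_cons h] at this
          · rw [← h7]
            simp only [List.sum_cons]
            ring
        · exact Or.inl ⟨⟨h1, by omega, hy, h4, h6⟩, h7, h5⟩
    · rintro (h | ⟨t, k, ⟨h1, h2, h3⟩, hk, rfl⟩)
      · rcases l with _ | ⟨x, _ | ⟨y, t⟩⟩
        · exact ⟨trivial, h.2⟩
        · obtain ⟨⟨h1, h2, h3⟩, h⟩ := h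
          exact ⟨⟨h1, by omega, h3⟩, h⟩
        · obtain ⟨⟨h1, h2, h3, h4, h6⟩, h⟩ := h
          exact ⟨⟨h1, by omega, by omega, h4, h6⟩, h⟩
      · refine ⟨⟨le_rfl, by omega, le_rfl, le_rfl, h1⟩, ?_, fun h => ?_⟩
        · simp only [List.cons_append, List.nil_append, List.sum_cons, h2, ← hk]
          ring
        · rcases t with _ | ⟨y, t⟩
          · simp
          · simpa using h3 (by simp)
  · rintro n t ⟨⟨-, -, h1, -⟩, -⟩
    omega

/-- The two peeling relations alternate down to the pair (0, 0), contributing 1 - q^{r+1} and 1 -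
q^{2r+1} for each r < N. -/
theorem prod_mul_boundedGenFun (N : ℕ) :
    (∏ k ∈ Finset.range N, (1 + C (-1) * X ^ (1 + 1 * k))) *
      (∏ k ∈ Finset.range N, (1 + C (-1) * X ^ (1 + 2 * k))) * boundedGenFun N N = 1 := by
  induction N with
  | zero => simp [boundedGenFun_zero]
  | succ N ih =>
    have h1 := one_sub_mul_boundedGenFun_even N
    have h2 := one_sub_mul_boundedGenFun_odd N
    rw [← h1] at h2
    rw [← h2] at ih
    rw [Finset.prod_range_succ, Finset.prod_range_succ]
    refine Eq.trans ?_ ih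
    simp only [map_neg, map_one]
    ring

theorem progProd_mul_progProd_mul_genFun :
    progProd (-1) 1 1 * progProd (-1) 1 2 * genFun 1 0 = 1 := by
  have lim : Tendsto (fun N => boundedGenFun N N) atTop (𝓝 (genFun 1 0)) := by
    rw [PowerSeries.WithPiTopology.tendsto_iff_coeff_tendsto]
    intro d
    refine tendsto_const_nhds.congr' ?_
    filter_upwards [eventually_ge_atTop d] with N hN
    rw [boundedGenFun, coeff_mk, boundedPartitions_eq_of_le hN, genFun, coeff_mk, one_mul,
      add_zero, j]
  refine tendsto_nhds_unique (((tendsto_progProd (-1) 1 one_pos).mul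
    (tendsto_progProd (-1) 1 two_pos)).mul lim) ?_
  simp_rw [prod_mul_boundedGenFun]
  exact tendsto_const_nhds

end Counting

/-! ### Theta series as products. -/

section Theta

theorem euler_eq_progProd (m : ℕ) : euler m = progProd (-1) m m := by
  rw [euler, qPochhammerInf, progProd]
  congr 1
  ext1 k
  rw [pow_add, pow_mul]
  simp only [map_neg, map_one]
  ring

theorem euler_ne_zero {m : ℕ} (hm : 0 < m) : euler m ≠ 0 := by
  intro h
  simpa [h] using constantCoeff_euler m hm

theorem expand_euler {r m : ℕ} (hr : r ≠ 0) (hm : 0 < m) :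
    expand r hr (euler m) = euler (r * m) := by
  rw [euler_eq_progProd, euler_eq_progProd, expand_progProd hr _ _ hm]

theorem progProd_odd_mul_euler {m : ℕ} (hm : 0 < m) :
    progProd (-1) m (2 * m) * euler (2 * m) = euler m := by
  rw [euler_eq_progProd, euler_eq_progProd, progProd_split_two _ m hm, ← two_mul]

theorem progProd_one_mul_euler {m : ℕ} (hm : 0 < m) :
    progProd 1 m m * euler m = euler (2 * m) := by
  rw [euler_eq_progProd, euler_eq_progProd, progProd_mul_neg _ _ hm, one_pow]

theorem progProd_one_odd_mul {m : ℕ} (hm : 0 < m) :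
    progProd (1 : ℚ) m (2 * m) * progProd (-1) m (2 * m) =
      progProd (-1) (2 * m) (2 * (2 * m)) := by
  rw [progProd_mul_neg _ _ (by omega), one_pow]

/-- The theta series `φ(q^m) = ∑_j q^{m j²}`, in product form. -/
noncomputable def phiPos (m : ℕ) : ℚ⟦X⟧ := progProd 1 m (2 * m) ^ 2 * euler (2 * m)

/-- The theta series `φ(-q^m) = ∑_j (-1)^j q^{m j²}`, in product form. -/
noncomputable def phiNeg (m : ℕ) : ℚ⟦X⟧ := progProd (-1) m (2 * m) ^ 2 * euler (2 * m)

/-- The theta series `ψ(q^m) = ∑_{j ≥ 0} q^{m j (j + 1) / 2}`, in product form. -/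
noncomputable def psi (m : ℕ) : ℚ⟦X⟧ := progProd 1 m m ^ 2 * euler m

/-- The theta series `Ω(-q^m) = ∑_j (-1)^j q^{m (3 j² + 2 j)}`, in product form. -/
noncomputable def omegaNeg (m : ℕ) : ℚ⟦X⟧ :=
  progProd (-1) (5 * m) (6 * m) * progProd (-1) m (6 * m) * euler (6 * m)

theorem phiNeg_mul_euler {m : ℕ} (hm : 0 < m) : phiNeg m * euler (2 * m) = euler m ^ 2 := by
  rw [phiNeg, ← progProd_odd_mul_euler hm]
  ring

theorem phiPos_mul_euler {m : ℕ} (hm : 0 < m) :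
    phiPos m * (euler m ^ 2 * euler (4 * m) ^ 2) = euler (2 * m) ^ 5 := by
  have h1 := progProd_odd_mul_euler hm
  have h2 := progProd_odd_mul_euler (show 0 < 2 * m by omega)
  have h3 := progProd_one_odd_mul hm
  rw [← mul_assoc] at h2 h3
  norm_num at h2 h3
  rw [phiPos]
  calc _ = (progProd 1 m (2 * m) * euler m * euler (4 * m)) ^ 2 * euler (2 * m) := by ring
    _ = (progProd 1 m (2 * m) * progProd (-1) m (2 * m) * euler (4 * m)) ^ 2 *
        euler (2 * m) ^ 3 := by rw [← h1]; ring
    _ = _ := by rw [h3, h2]; ring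

theorem psi_mul_euler {m : ℕ} (hm : 0 < m) : psi m * euler m = euler (2 * m) ^ 2 := by
  rw [psi, ← progProd_one_mul_euler hm]
  ring

/-- Odd multiples of m split modulo 6m into the classes m, 3m and 5m; the class 3m is the quotient
of (q^{3m};q^{3m})_∞ by (q^{6m};q^{6m})_∞. -/
theorem omegaNeg_mul_euler {m : ℕ} (hm : 0 < m) :
    omegaNeg m * (euler (2 * m) * euler (3 * m)) = euler m * euler (6 * m) ^ 2 := by
  have h1 := progProd_odd_mul_euler hm
  have h2 := progProd_odd_mul_euler (show 0 < 3 * m by omega)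
  have h3 := progProd_split_three (-1 : ℚ) m (show 0 < 2 * m by omega)
  rw [← mul_assoc] at h2 h3
  rw [show m + 2 * m = 3 * m by ring, show m + 2 * (2 * m) = 5 * m by ring] at h3
  norm_num at h2 h3
  rw [omegaNeg, ← h1, h3, ← h2]
  ring

theorem phiPos_mul_phiNeg {m : ℕ} (hm : 0 < m) :
    phiPos m * phiNeg m = phiNeg (2 * m) ^ 2 := by
  have h2 := progProd_odd_mul_euler (show 0 < 2 * m by omega)
  have h3 := progProd_one_odd_mul hm
  rw [phiPos, phiNeg, phiNeg]
  calc _ = (progProd (1 : ℚ) m (2 * m) * progProd (-1) m (2 * m)) ^ 2 * euler (2 * m) ^ 2 := by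
        ring
    _ = _ := by rw [h3, ← h2]; ring

theorem expand_phiPos {r m : ℕ} (hr : r ≠ 0) (hm : 0 < m) :
    expand r hr (phiPos m) = phiPos (r * m) := by
  rw [phiPos, phiPos, map_mul, map_pow, expand_progProd hr _ _ (by omega),
    expand_euler hr (by omega), mul_left_comm]

theorem expand_phiNeg {r m : ℕ} (hr : r ≠ 0) (hm : 0 < m) :
    expand r hr (phiNeg m) = phiNeg (r * m) := by
  rw [phiNeg, phiNeg, map_mul, map_pow, expand_progProd hr _ _ (by omega),
    expand_euler hr (by omega), mul_left_comm]

theorem expand_psi {r m : ℕ} (hr : r ≠ 0) (hm : 0 < m) :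
    expand r hr (psi m) = psi (r * m) := by
  rw [psi, psi, map_mul, map_pow, expand_progProd hr _ _ hm, expand_euler hr hm]

theorem expand_omegaNeg {r m : ℕ} (hr : r ≠ 0) (hm : 0 < m) :
    expand r hr (omegaNeg m) = omegaNeg (r * m) := by
  rw [omegaNeg, omegaNeg, map_mul, map_mul, expand_progProd hr _ _ (by omega),
    expand_progProd hr _ _ (by omega), expand_euler hr (by omega), mul_left_comm r 5,
    mul_left_comm r 6]

/-! ### Splitting theta series by residues of the summation index. -/

/-- The sum of a convergent series over `ℤ` is the sum over the residue classes modulo `n`. -/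
theorem hasSum_eq_sum_residues {α : Type*} [AddCommMonoid α] [TopologicalSpace α] [T2Space α]
    [ContinuousAdd α] [RegularSpace α] (n : ℕ) [NeZero n] {f : ℤ → α} {s : α} {a : Fin n → α}
    (hf : HasSum f s) (h : ∀ i : Fin n, HasSum (fun k : ℤ => f (k * n + (i : ℕ))) (a i)) :
    s = ∑ i, a i := by
  rw [← (Int.divModEquiv n).symm.hasSum_iff, ← (Equiv.prodComm (Fin n) ℤ).hasSum_iff] at hf
  refine (hf.prod_fiberwise (g := a) fun i => ?_).unique (hasSum_fintype a)
  convert h i using 2 with k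
  simp [Int.divModEquiv]

theorem hasSum_eq_add_even_odd {f : ℤ → ℚ⟦X⟧} {s a b : ℚ⟦X⟧} (hf : HasSum f s)
    (h0 : HasSum (fun k : ℤ => f (k * 2)) a) (h1 : HasSum (fun k : ℤ => f (k * 2 + 1)) b) :
    s = a + b := by
  rw [hasSum_eq_sum_residues 2 hf (a := ![a, b]), Fin.sum_univ_two]
  · rfl
  · rw [Fin.forall_fin_two]
    exact ⟨by simpa using h0, by simpa using h1⟩

theorem hasSum_eq_add_residues_three {f : ℤ → ℚ⟦X⟧} {s a b c : ℚ⟦X⟧} (hf : HasSum f s)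
    (h0 : HasSum (fun k : ℤ => f (k * 3)) a) (h1 : HasSum (fun k : ℤ => f (k * 3 + 1)) b)
    (h2 : HasSum (fun k : ℤ => f (k * 3 + 2)) c) : s = a + b + c := by
  rw [hasSum_eq_sum_residues 3 hf (a := ![a, b, c]), Fin.sum_univ_three]
  · rfl
  · rw [Fin.forall_fin_succ, Fin.forall_fin_two]
    exact ⟨by simpa using h0, by simpa using h1, by simpa using h2⟩

theorem exists_quadratic_exponent {A B : ℕ} (hB : B ≤ A) :
    ∃ e : ℤ → ℕ, ∀ k, (e k : ℤ) = A * k ^ 2 + B * k := by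
  refine ⟨fun k => (A * k ^ 2 + B * k : ℤ).toNat, fun k => Int.toNat_of_nonneg ?_⟩
  have hB' : (B : ℤ) ≤ A := by exact_mod_cast hB
  rcases le_total 0 k with h | h
  · positivity
  · rcases eq_or_lt_of_le h with rfl | h
    · simp
    · nlinarith [mul_nonneg (Int.natCast_nonneg A)
        (mul_nonneg (show 0 ≤ -k by omega) (show 0 ≤ -k - 1 by omega)),
        mul_nonneg (sub_nonneg.mpr hB') (show 0 ≤ -k by omega)]

/-- Even indices give exponents 4k², odd ones 4k² + 4k + 1. -/
theorem phiPos_one_eq : phiPos 1 = phiPos 4 + 2 * X * psi 8 := by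
  obtain ⟨e, he⟩ := exists_quadratic_exponent (A := 1) (B := 0) (by omega)
  obtain ⟨e0, he0⟩ := exists_quadratic_exponent (A := 4) (B := 0) (by omega)
  obtain ⟨e1, he1⟩ := exists_quadratic_exponent (A := 4) (B := 4) (by omega)
  have h := hasSum_tripleProduct one_pos (by omega) (one_ne_zero (α := ℚ)) he
  have h0 := hasSum_tripleProduct (by omega) (by omega) (one_ne_zero (α := ℚ)) he0
  have h1 := hasSum_tripleProduct (by omega) (by omega) (one_ne_zero (α := ℚ)) he1
  have key := hasSum_eq_add_even_odd h (h0.congr_fun fun k => ?_)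
    ((h1.mul_left X).congr_fun fun k => ?_)
  · simp only [inv_one, ← euler_eq_progProd] at key
    norm_num at key
    -- For A = B = 4 one product starts at exponent 0; its first factor 1 + 1 is the coefficient 2.
    rw [progProd_zero _ (by norm_num)] at key
    rw [phiPos, phiPos, psi]
    have h2 : (C 2 : ℚ⟦X⟧) = 2 := map_ofNat C 2
    norm_num [h2] at key ⊢
    linear_combination key
  · have hk : e (k * 2) = e0 k := by
      zify
      rw [he, he0]
      push_cast
      ring
    simp [hk]
  · have hk : e (k * 2 + 1) = e1 k + 1 := by
      zify
      rw [he, he1]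
      push_cast
      ring
    simp [hk, pow_succ']

theorem phiNeg_one_eq : phiNeg 1 = phiNeg 9 - 2 * X * omegaNeg 3 := by
  have hz : (-1 : ℚ) ≠ 0 := by norm_num
  obtain ⟨e, he⟩ := exists_quadratic_exponent (A := 1) (B := 0) (by omega)
  obtain ⟨e0, he0⟩ := exists_quadratic_exponent (A := 9) (B := 0) (by omega)
  obtain ⟨e1, he1⟩ := exists_quadratic_exponent (A := 9) (B := 6) (by omega)
  have h := hasSum_tripleProduct one_pos (by omega) hz he
  have h0 := hasSum_tripleProduct (by omega) (by omega) hz he0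
  have h1 := hasSum_tripleProduct (by omega) (by omega) hz he1
  have hsign : ∀ k : ℤ, (-1 : ℚ) ^ (k * 3) = (-1) ^ k := fun k => by
    rw [mul_comm, zpow_mul]
    norm_num
  -- The class 3k + 2 becomes the class 3k + 1 under k ↦ -1 - k, since j ↦ -j preserves j² and
  -- (-1)^j. Hence the coefficient 2.
  have key := hasSum_eq_add_residues_three h (h0.congr_fun fun k => ?_)
    ((h1.mul_left (-X)).congr_fun fun k => ?_)
    ((Equiv.subLeft (-1 : ℤ)).hasSum_iff.mp ((h1.mul_left (-X)).congr_fun fun k => ?_))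
  · simp only [← euler_eq_progProd] at key
    rw [phiNeg, phiNeg, omegaNeg]
    norm_num at key ⊢
    linear_combination key
  · have hk : e (k * 3) = e0 k := by
      zify
      rw [he, he0]
      push_cast
      ring
    rw [hk, hsign]
  · have hk : e (k * 3 + 1) = e1 k + 1 := by
      zify
      rw [he, he1]
      push_cast
      ring
    rw [hk, zpow_add_one₀ hz, hsign, mul_neg_one, map_neg]
    ring
  · have hk : e ((-1 - k) * 3 + 2) = e1 k + 1 := by
      zify
      rw [he, he1]
      push_cast
      ring
    have hs : (-1 : ℚ) ^ ((-1 - k) * 3 + 2) = -(-1) ^ k := by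
      rw [zpow_add₀ hz, hsign, zpow_sub₀ hz]
      rcases Int.even_or_odd k with h | h <;> simp [h.neg_one_zpow]
    rw [Function.comp_apply, Equiv.subLeft_apply, hk, hs, map_neg]
    ring

end Theta

/-! ### Power identities for theta series, by roots of unity. -/

section Dissection

theorem rescale_expand {R : Type*} [CommRing R] {r : ℕ} (hr : r ≠ 0) {ω : R} (hω : ω ^ r = 1)
    (f : R⟦X⟧) : rescale ω (expand r hr f) = expand r hr f := by
  ext n
  rw [coeff_rescale, coeff_expand]
  split_ifs with h
  · obtain ⟨k, rfl⟩ := h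
    rw [pow_mul, hω, one_pow, one_mul]
  · rw [mul_zero]

theorem rescale_neg_one_phiPos_one : rescale (-1) (phiPos 1) = phiNeg 1 := by
  rw [phiPos, phiNeg, map_mul, map_pow, rescale_progProd _ _ (by norm_num) (by norm_num),
    euler_eq_progProd, rescale_progProd _ _ (by norm_num) (by norm_num)]
  norm_num

theorem rescale_neg_one_phiNeg_one : rescale (-1) (phiNeg 1) = phiPos 1 := by
  rw [phiPos, phiNeg, map_mul, map_pow, rescale_progProd _ _ (by norm_num) (by norm_num),
    euler_eq_progProd, rescale_progProd _ _ (by norm_num) (by norm_num)]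
  norm_num

theorem expand_injective {R : Type*} [CommRing R] {r : ℕ} (hr : r ≠ 0) :
    Function.Injective (expand r hr : R⟦X⟧ →ₐ[R] R⟦X⟧) := fun f g h => by
  ext n
  rw [← coeff_expand_mul r hr f, h, coeff_expand_mul]

/-- Multiplying φ(±q) = φ(q⁴) ± 2qψ(q⁸) gives φ(-q²)² = φ(q⁴)² - 4q²ψ(q⁸)². Replacing q² by q, then
q by -q, then q by q² changes the signs. -/
theorem phiPos_two_sq : phiPos 2 ^ 2 = phiPos 4 ^ 2 + 4 * X ^ 2 * psi 8 ^ 2 := by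
  have two : (2 : ℕ) ≠ 0 := two_ne_zero
  have sq1 : (-1 : ℚ) ^ 2 = 1 := by norm_num
  have eP : ∀ m, 0 < m → rescale (-1) (phiPos (2 * m)) = phiPos (2 * m) := fun m hm => by
    rw [← expand_phiPos two hm, rescale_expand two sq1]
  have ePsi : ∀ m, 0 < m → rescale (-1) (psi (2 * m)) = psi (2 * m) := fun m hm => by
    rw [← expand_psi two hm, rescale_expand two sq1]
  have hX : rescale (-1) (X : ℚ⟦X⟧) = -X := by rw [rescale_X]; simp
  have h4 := eP 2 two_pos
  have h8 := ePsi 4 (by norm_num)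
  norm_num at h4 h8
  have hneg : phiNeg 1 = phiPos 4 - 2 * X * psi 8 := by
    rw [← rescale_neg_one_phiPos_one, phiPos_one_eq, map_add, map_mul, map_mul, h4, h8, hX,
      map_ofNat]
    ring
  have hsq : phiNeg 1 ^ 2 = phiPos 2 ^ 2 - 4 * X * psi 4 ^ 2 := by
    apply expand_injective two
    simp only [map_sub, map_mul, map_pow, map_ofNat, expand_X, expand_phiNeg two one_pos,
      expand_phiPos two two_pos, expand_psi two (show 0 < 4 by norm_num)]
    rw [← phiPos_mul_phiNeg one_pos, hneg, phiPos_one_eq]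
    norm_num
    ring
  have hpos : phiPos 1 ^ 2 = phiPos 2 ^ 2 + 4 * X * psi 4 ^ 2 := by
    have h2 := eP 1 one_pos
    have h4 := ePsi 2 two_pos
    norm_num at h2 h4
    rw [← rescale_neg_one_phiNeg_one, ← map_pow, hsq, map_sub, map_mul, map_mul, map_pow, map_pow,
      h2, h4, hX, map_ofNat]
    ring
  have := congrArg (expand 2 two) hpos
  simp only [map_add, map_mul, map_pow, map_ofNat, expand_X, expand_phiPos two one_pos,
    expand_phiPos two two_pos, expand_psi two (show 0 < 4 by norm_num)] at this
  norm_num only at this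
  exact this

theorem exists_cube_root : ∃ ω : ℂ, 1 + ω + ω ^ 2 = 0 := by
  have h := Complex.isPrimitiveRoot_exp 3 (by norm_num)
  have h0 := h.geom_sum_eq_zero (by norm_num)
  simp only [Finset.sum_range_succ, Finset.sum_range_zero, zero_add, pow_zero, pow_one] at h0
  exact ⟨_, h0⟩

theorem map_euler_complex {m : ℕ} (hm : 0 < m) :
    PowerSeries.map (algebraMap ℚ ℂ) (euler m) = progProd (-1) m m := by
  rw [euler_eq_progProd, map_progProd _ (continuous_algebraMap ℚ ℂ) _ _ hm]
  simp

/-- The product of φ(-ζq) over ζ³ = 1 is computed twice: from the 3-dissection, whose components are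
series in q³, and from φ(-q) = (q;q)_∞²/(q²;q²)_∞ with `prod_rescale_cube_root_progProd`. The cube
roots require passing to ℂ. -/
theorem phiNeg_nine_cube :
    (phiNeg 9 ^ 3 - 8 * X ^ 3 * omegaNeg 3 ^ 3) * phiNeg 9 = phiNeg 3 ^ 4 := by
  apply PowerSeries.map_injective (algebraMap ℚ ℂ) (algebraMap ℚ ℂ).injective
  set ι := PowerSeries.map (algebraMap ℚ ℂ) with hι
  obtain ⟨ω, hω⟩ := exists_cube_root
  have three : (3 : ℕ) ≠ 0 := by norm_num
  have h3 : ω ^ 3 = 1 := by linear_combination (ω - 1) * hω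
  have h3' : (ω ^ 2) ^ 3 = 1 := by rw [← pow_mul, mul_comm, pow_mul, h3, one_pow]
  have n1 := prod_rescale_cube_root_progProd hω one_pos (Or.inl (pow_one ω))
  have n2 := prod_rescale_cube_root_progProd hω two_pos (Or.inr rfl)
  norm_num only at n1 n2
  simp only [← map_euler_complex (show 0 < 1 by norm_num),
    ← map_euler_complex (show 0 < 3 by norm_num), ← map_euler_complex (show 0 < 9 by norm_num),
    ← hι] at n1
  simp only [← map_euler_complex (show 0 < 2 by norm_num),
    ← map_euler_complex (show 0 < 6 by norm_num), ← map_euler_complex (show 0 < 18 by norm_num),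
    ← hι] at n2
  have t1 := congrArg ι (phiNeg_mul_euler one_pos)
  have t3 := congrArg ι (phiNeg_mul_euler (show 0 < 3 by norm_num))
  have t9 := congrArg ι (phiNeg_mul_euler (show 0 < 9 by norm_num))
  norm_num only [map_mul, map_pow] at t1 t3 t9
  have fixA : ∀ ζ : ℂ, ζ ^ 3 = 1 → rescale ζ (ι (phiNeg 9)) = ι (phiNeg 9) := fun ζ hζ => by
    have := expand_phiNeg three (show 0 < 3 by norm_num)
    norm_num only at this
    rw [← this, hι, map_expand, rescale_expand three hζ]
  have fixC : ∀ ζ : ℂ, ζ ^ 3 = 1 → rescale ζ (ι (omegaNeg 3)) = ι (omegaNeg 3) := fun ζ hζ => by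
    have := expand_omegaNeg three one_pos
    norm_num only at this
    rw [← this, hι, map_expand, rescale_expand three hζ]
  have hX : ι X = X := map_X _
  have hT : ι (phiNeg 1) = ι (phiNeg 9) - 2 * X * ι (omegaNeg 3) := by
    rw [phiNeg_one_eq, map_sub, map_mul, map_mul, map_ofNat, hX]
  have hTζ : ∀ ζ : ℂ, ζ ^ 3 = 1 → rescale ζ (ι (phiNeg 1)) =
      ι (phiNeg 9) - 2 * (C ζ * X) * ι (omegaNeg 3) := fun ζ hζ => by
    rw [hT, map_sub, map_mul, map_mul, map_ofNat, rescale_X, fixA ζ hζ, fixC ζ hζ]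
  have t1ω := congrArg (rescale ω) t1
  have t1ω' := congrArg (rescale (ω ^ 2)) t1
  rw [map_mul, map_pow, hTζ ω h3] at t1ω
  rw [map_mul, map_pow, hTζ (ω ^ 2) h3'] at t1ω'
  rw [hT] at t1
  have hC : (1 + C ω + C ω ^ 2 : ℂ⟦X⟧) = 0 := by
    rw [← map_pow, ← map_one C, ← map_add, ← map_add, hω, map_zero]
  have hC3 : (C ω ^ 3 : ℂ⟦X⟧) = 1 := by rw [← map_pow, h3, map_one]
  rw [map_mul, map_sub, map_mul, map_mul, map_pow, map_pow, map_pow, map_pow, map_ofNat, hX]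
  rw [map_pow] at t1ω'
  set a := ι (phiNeg 9)
  set c := ι (omegaNeg 3)
  have hN : a ^ 3 - 8 * X ^ 3 * c ^ 3 = (a - 2 * X * c) * (a - 2 * (C ω * X) * c) *
      (a - 2 * (C ω ^ 2 * X) * c) := by
    linear_combination (2 * X * c * a ^ 2 - 4 * X ^ 2 * c ^ 2 * C ω * a) * hC +
      8 * X ^ 3 * c ^ 3 * hC3
  have nz : ∀ m, 0 < m → ι (euler m) ≠ 0 := fun m hm h =>
    euler_ne_zero hm (PowerSeries.map_injective (algebraMap ℚ ℂ) (algebraMap ℚ ℂ).injective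
      (by rw [← hι, h, map_zero]))
  refine mul_right_cancel₀ (mul_ne_zero (pow_ne_zero 4 (nz 6 (by norm_num)))
    (pow_ne_zero 2 (nz 9 (by norm_num)))) ?_
  rw [hN]
  calc _ = (a - 2 * X * c) * (a - 2 * (C ω * X) * c) * (a - 2 * (C ω ^ 2 * X) * c) * a *
        ι (euler 6) ^ 4 * ι (euler 9) ^ 2 := by ring
    _ = ((a - 2 * X * c) * ι (euler 2)) * ((a - 2 * (C ω * X) * c) * rescale ω (ι (euler 2))) *
        ((a - 2 * (C ω ^ 2 * X) * c) * rescale (ω ^ 2) (ι (euler 2))) * (a * ι (euler 18)) *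
        ι (euler 9) ^ 2 := by rw [← n2]; ring
    _ = (ι (euler 1) * rescale ω (ι (euler 1)) * rescale (ω ^ 2) (ι (euler 1)) *
        ι (euler 9)) ^ 2 * ι (euler 9) ^ 2 := by rw [t1, t1ω, t1ω', t9]; ring
    _ = (ι (phiNeg 3) * ι (euler 6)) ^ 4 * ι (euler 9) ^ 2 := by rw [n1, t3]; ring
    _ = _ := by ring

/-! ### Dissecting 1/φ(-q). -/

theorem genFun_mul_phiNeg : genFun 1 0 * phiNeg 1 = 1 := by
  have h := progProd_mul_progProd_mul_genFun
  have h1 := progProd_odd_mul_euler one_pos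
  rw [← euler_eq_progProd, ← h1] at h
  rw [phiNeg]
  norm_num at h ⊢
  linear_combination h

theorem coeff_X_pow_mul_expand {r i s : ℕ} (hr : r ≠ 0) (hi : i < r) (hs : s < r) (n : ℕ)
    (f : ℚ⟦X⟧) :
    coeff (r * n + s) (X ^ i * expand r hr f) = if i = s then coeff n f else 0 := by
  rw [coeff_X_pow_mul', coeff_expand]
  by_cases h : i = s
  · subst h
    rw [if_pos (by omega), if_pos rfl, Nat.add_sub_cancel, if_pos (dvd_mul_right r n),
      Nat.mul_div_cancel_left _ (by omega)]
  · rw [if_neg h]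
    split_ifs with h1 h2
    · exfalso
      obtain ⟨k, hk⟩ := h2
      have hk' : r * n + s = r * k + i := by omega
      have h3 := congrArg (· % r) hk'
      simp only [Nat.mul_add_mod, Nat.mod_eq_of_lt hi, Nat.mod_eq_of_lt hs] at h3
      exact h h3.symm
    · rfl
    · rfl

/-- If `W ≠ 0` and `W ∑ j(n) q^n = ∑_{i < r} q^i W F_i(q^r)`, then `∑ j(r n + i) q^n = F_i`. -/
theorem genFun_eq_of_dissection {r : ℕ} (hr : r ≠ 0) {W : ℚ⟦X⟧} (hW : W ≠ 0) {F : Fin r → ℚ⟦X⟧}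
    (h : genFun 1 0 * W = ∑ i : Fin r, X ^ (i : ℕ) * (expand r hr (F i) * W)) (s : Fin r) :
    genFun r s = F s := by
  have h' : genFun 1 0 = ∑ i : Fin r, X ^ (i : ℕ) * expand r hr (F i) := by
    refine mul_right_cancel₀ hW ?_
    rw [h, Finset.sum_mul]
    exact Finset.sum_congr rfl fun i _ => by ring
  ext n
  have h2 := congrArg (coeff (r * n + s)) h'
  simp only [map_sum, coeff_X_pow_mul_expand hr (Fin.is_lt _) s.is_lt, Fin.val_inj,
    Finset.sum_ite_eq', Finset.mem_univ, if_true] at h2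
  rw [← h2, genFun, genFun, coeff_mk, coeff_mk, one_mul, add_zero]

theorem expand_mul_inv_mul {r : ℕ} (hr : r ≠ 0) (N : ℚ⟦X⟧) {D : ℚ⟦X⟧}
    (hD : constantCoeff D = 1) :
    expand r hr (N * D⁻¹) * expand r hr D = expand r hr N := by
  rw [← map_mul, mul_assoc, PowerSeries.inv_mul_cancel _ (by rw [hD]; exact one_ne_zero), mul_one]

theorem phiNeg_ne_zero {m : ℕ} (hm : 0 < m) : phiNeg m ≠ 0 := by
  intro h
  have := phiNeg_mul_euler hm
  rw [h, zero_mul] at this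
  exact pow_ne_zero 2 (euler_ne_zero hm) this.symm

theorem genFun_mul_phiNeg_two_sq : genFun 1 0 * phiNeg 2 ^ 2 = phiPos 4 + 2 * X * psi 8 := by
  have h := phiPos_mul_phiNeg one_pos
  rw [mul_one] at h
  rw [← phiPos_one_eq, ← h]
  linear_combination phiPos 1 * genFun_mul_phiNeg

/-- Multiplying by φ(q²)² completes the denominator, as φ(-q²)²φ(q²)² = φ(-q⁴)⁴. -/
theorem genFun_mul_phiNeg_four_pow : genFun 1 0 * phiNeg 4 ^ 4 =
    phiPos 4 ^ 3 + 2 * X * (phiPos 4 ^ 2 * psi 8) + 4 * X ^ 2 * (phiPos 4 * psi 8 ^ 2) +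
      8 * X ^ 3 * psi 8 ^ 3 := by
  have h := phiPos_mul_phiNeg two_pos
  norm_num at h
  calc _ = genFun 1 0 * (phiNeg 4 ^ 2) ^ 2 := by ring
    _ = (genFun 1 0 * phiNeg 2 ^ 2) * phiPos 2 ^ 2 := by rw [← h]; ring
    _ = _ := by rw [genFun_mul_phiNeg_two_sq, phiPos_two_sq]; ring

/-- The cofactor of a - b in a³ - b³, with a = φ(-q⁹) and b = 2qΩ(-q³), supplies the three
numerators. -/
theorem genFun_mul_phiNeg_three_pow : genFun 1 0 * phiNeg 3 ^ 4 =
    phiNeg 9 ^ 3 + 2 * X * (phiNeg 9 ^ 2 * omegaNeg 3) +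
      4 * X ^ 2 * (phiNeg 9 * omegaNeg 3 ^ 2) := by
  have h := genFun_mul_phiNeg
  rw [phiNeg_one_eq] at h
  rw [← phiNeg_nine_cube]
  linear_combination phiNeg 9 * (phiNeg 9 ^ 2 + 2 * X * phiNeg 9 * omegaNeg 3 +
    4 * X ^ 2 * omegaNeg 3 ^ 2) * h

end Dissection

/-! ### The components as quotients of Euler products. -/

/-- In theta form the components are φ(q²)/φ(-q)² and 2ψ(q⁴)/φ(-q)². -/
theorem genFun_two_eq :
    genFun 2 0 = euler 4 ^ 5 * (euler 1 ^ 4 * euler 8 ^ 2)⁻¹ ∧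
    genFun 2 1 = 2 * (euler 2 ^ 2 * euler 8 ^ 2) * (euler 1 ^ 4 * euler 4)⁻¹ := by
  have two : (2 : ℕ) ≠ 0 := two_ne_zero
  set F : Fin 2 → ℚ⟦X⟧ := ![euler 4 ^ 5 * (euler 1 ^ 4 * euler 8 ^ 2)⁻¹,
    2 * (euler 2 ^ 2 * euler 8 ^ 2) * (euler 1 ^ 4 * euler 4)⁻¹]
  have g0 := expand_mul_inv_mul two (euler 4 ^ 5) (D := euler 1 ^ 4 * euler 8 ^ 2)
    (by simp [constantCoeff_euler])
  have g1 := expand_mul_inv_mul two (2 * (euler 2 ^ 2 * euler 8 ^ 2)) (D := euler 1 ^ 4 * euler 4)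
    (by simp [constantCoeff_euler])
  have ex : ∀ m, 0 < m → expand 2 two (euler m) = euler (2 * m) := fun m => expand_euler two
  -- Folding the quotient into `F 0` keeps `map_mul` from distributing over the inverse.
  change expand 2 two (F 0) * _ = _ at g0
  change expand 2 two (F 1) * _ = _ at g1
  norm_num only [map_mul, map_pow, map_ofNat, ex] at g0 g1
  have hn := phiNeg_mul_euler two_pos
  have hp := phiPos_mul_euler (show 0 < 4 by norm_num)
  have hs := psi_mul_euler (show 0 < 8 by norm_num)
  norm_num only at hn hp hs
  have E4 := euler_ne_zero (show 0 < 4 by norm_num)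
  have E8 := euler_ne_zero (show 0 < 8 by norm_num)
  have E16 := euler_ne_zero (show 0 < 16 by norm_num)
  have c0 : expand 2 two (F 0) * phiNeg 2 ^ 2 = phiPos 4 := by
    refine mul_right_cancel₀ (mul_ne_zero (pow_ne_zero 2 E4) (pow_ne_zero 2 E16)) ?_
    calc _ = expand 2 two (F 0) * (phiNeg 2 * euler 4) ^ 2 * euler 16 ^ 2 := by ring
      _ = expand 2 two (F 0) * (euler 2 ^ 4 * euler 16 ^ 2) := by rw [hn]; ring
      _ = _ := by rw [g0, hp]
  have c1 : expand 2 two (F 1) * phiNeg 2 ^ 2 = 2 * psi 8 := by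
    refine mul_right_cancel₀ (mul_ne_zero (pow_ne_zero 2 E4) E8) ?_
    calc _ = expand 2 two (F 1) * (phiNeg 2 * euler 4) ^ 2 * euler 8 := by ring
      _ = expand 2 two (F 1) * (euler 2 ^ 4 * euler 8) := by rw [hn]; ring
      _ = 2 * (psi 8 * euler 8) * euler 4 ^ 2 := by rw [g1, hs]; ring
      _ = _ := by ring
  have h := genFun_eq_of_dissection two (pow_ne_zero 2 (phiNeg_ne_zero two_pos)) (F := F) (by
    rw [Fin.sum_univ_two, c0, c1, genFun_mul_phiNeg_two_sq, Fin.val_zero, Fin.val_one]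
    ring)
  exact ⟨h 0, h 1⟩

/-- In theta form the components are φ(-q³)^{3-i} (2Ω(-q))^i / φ(-q)⁴ for i = 0, 1, 2. -/
theorem genFun_three_eq :
    genFun 3 0 = euler 2 ^ 4 * euler 3 ^ 6 * (euler 1 ^ 8 * euler 6 ^ 3)⁻¹ ∧
    genFun 3 1 = 2 * (euler 2 ^ 3 * euler 3 ^ 3) * (euler 1 ^ 7)⁻¹ ∧
    genFun 3 2 = 4 * (euler 2 ^ 2 * euler 6 ^ 3) * (euler 1 ^ 6)⁻¹ := by
  have three : (3 : ℕ) ≠ 0 := three_ne_zero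
  set F : Fin 3 → ℚ⟦X⟧ := ![euler 2 ^ 4 * euler 3 ^ 6 * (euler 1 ^ 8 * euler 6 ^ 3)⁻¹,
    2 * (euler 2 ^ 3 * euler 3 ^ 3) * (euler 1 ^ 7)⁻¹,
    4 * (euler 2 ^ 2 * euler 6 ^ 3) * (euler 1 ^ 6)⁻¹]
  have g0 := expand_mul_inv_mul three (euler 2 ^ 4 * euler 3 ^ 6) (D := euler 1 ^ 8 * euler 6 ^ 3)
    (by simp [constantCoeff_euler])
  have g1 := expand_mul_inv_mul three (2 * (euler 2 ^ 3 * euler 3 ^ 3)) (D := euler 1 ^ 7)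
    (by simp [constantCoeff_euler])
  have g2 := expand_mul_inv_mul three (4 * (euler 2 ^ 2 * euler 6 ^ 3)) (D := euler 1 ^ 6)
    (by simp [constantCoeff_euler])
  have ex : ∀ m, 0 < m → expand 3 three (euler m) = euler (3 * m) := fun m => expand_euler three
  change expand 3 three (F 0) * _ = _ at g0
  change expand 3 three (F 1) * _ = _ at g1
  change expand 3 three (F 2) * _ = _ at g2
  norm_num only [map_mul, map_pow, map_ofNat, ex] at g0 g1 g2
  have h3 := phiNeg_mul_euler (show 0 < 3 by norm_num)
  have h9 := phiNeg_mul_euler (show 0 < 9 by norm_num)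
  have ho := omegaNeg_mul_euler (show 0 < 3 by norm_num)
  norm_num only at h3 h9 ho
  have E6 := euler_ne_zero (show 0 < 6 by norm_num)
  have E9 := euler_ne_zero (show 0 < 9 by norm_num)
  have E18 := euler_ne_zero (show 0 < 18 by norm_num)
  have c0 : expand 3 three (F 0) * phiNeg 3 ^ 4 = phiNeg 9 ^ 3 := by
    refine mul_right_cancel₀ (mul_ne_zero (pow_ne_zero 4 E6) (pow_ne_zero 3 E18)) ?_
    calc _ = expand 3 three (F 0) * (phiNeg 3 * euler 6) ^ 4 * euler 18 ^ 3 := by ring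
      _ = expand 3 three (F 0) * (euler 3 ^ 8 * euler 18 ^ 3) := by rw [h3]; ring
      _ = (phiNeg 9 * euler 18) ^ 3 * euler 6 ^ 4 := by rw [g0, h9]; ring
      _ = _ := by ring
  have c1 : expand 3 three (F 1) * phiNeg 3 ^ 4 = 2 * (phiNeg 9 ^ 2 * omegaNeg 3) := by
    refine mul_right_cancel₀ (mul_ne_zero (mul_ne_zero (pow_ne_zero 4 E6) (pow_ne_zero 2 E18))
      (mul_ne_zero E6 E9)) ?_
    calc _ = expand 3 three (F 1) * (phiNeg 3 * euler 6) ^ 4 *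
          (euler 18 ^ 2 * euler 6 * euler 9) := by ring
      _ = expand 3 three (F 1) * euler 3 ^ 7 *
          (euler 3 * euler 18 ^ 2 * euler 6 * euler 9) := by rw [h3]; ring
      _ = 2 * (phiNeg 9 * euler 18) ^ 2 * (omegaNeg 3 * (euler 6 * euler 9)) * euler 6 ^ 4 := by
        rw [g1, h9, ho]; ring
      _ = _ := by ring
  have c2 : expand 3 three (F 2) * phiNeg 3 ^ 4 = 4 * (phiNeg 9 * omegaNeg 3 ^ 2) := by
    refine mul_right_cancel₀ (mul_ne_zero (mul_ne_zero (pow_ne_zero 4 E6) E18)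
      (pow_ne_zero 2 (mul_ne_zero E6 E9))) ?_
    calc _ = expand 3 three (F 2) * (phiNeg 3 * euler 6) ^ 4 *
          (euler 18 * euler 6 ^ 2 * euler 9 ^ 2) := by ring
      _ = expand 3 three (F 2) * euler 3 ^ 6 *
          (euler 3 ^ 2 * euler 18 * euler 6 ^ 2 * euler 9 ^ 2) := by rw [h3]; ring
      _ = 4 * (phiNeg 9 * euler 18) * (omegaNeg 3 * (euler 6 * euler 9)) ^ 2 * euler 6 ^ 4 := by
        rw [g2, h9, ho]; ring
      _ = _ := by ring
  have h := genFun_eq_of_dissection three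
    (pow_ne_zero 4 (phiNeg_ne_zero (show 0 < 3 by norm_num))) (F := F) (by
      rw [Fin.sum_univ_three, c0, c1, c2, genFun_mul_phiNeg_three_pow, Fin.val_zero, Fin.val_one,
        Fin.val_two]
      ring)
  exact ⟨h 0, h 1, h 2⟩

/-- In theta form the components are φ(q)^{3-i} (2ψ(q²))^i / φ(-q)⁴ for i = 0, 1, 2, 3. -/
theorem genFun_four_eq :
    genFun 4 0 = euler 2 ^ 19 * (euler 1 ^ 14 * euler 4 ^ 6)⁻¹ ∧
    genFun 4 1 = 2 * euler 2 ^ 13 * (euler 1 ^ 12 * euler 4 ^ 2)⁻¹ ∧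
    genFun 4 2 = 4 * (euler 2 ^ 7 * euler 4 ^ 2) * (euler 1 ^ 10)⁻¹ ∧
    genFun 4 3 = 8 * (euler 2 * euler 4 ^ 6) * (euler 1 ^ 8)⁻¹ := by
  have four : (4 : ℕ) ≠ 0 := four_ne_zero
  set F : Fin 4 → ℚ⟦X⟧ := ![euler 2 ^ 19 * (euler 1 ^ 14 * euler 4 ^ 6)⁻¹,
    2 * euler 2 ^ 13 * (euler 1 ^ 12 * euler 4 ^ 2)⁻¹,
    4 * (euler 2 ^ 7 * euler 4 ^ 2) * (euler 1 ^ 10)⁻¹,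
    8 * (euler 2 * euler 4 ^ 6) * (euler 1 ^ 8)⁻¹]
  have g0 := expand_mul_inv_mul four (euler 2 ^ 19) (D := euler 1 ^ 14 * euler 4 ^ 6)
    (by simp [constantCoeff_euler])
  have g1 := expand_mul_inv_mul four (2 * euler 2 ^ 13) (D := euler 1 ^ 12 * euler 4 ^ 2)
    (by simp [constantCoeff_euler])
  have g2 := expand_mul_inv_mul four (4 * (euler 2 ^ 7 * euler 4 ^ 2)) (D := euler 1 ^ 10)
    (by simp [constantCoeff_euler])
  have g3 := expand_mul_inv_mul four (8 * (euler 2 * euler 4 ^ 6)) (D := euler 1 ^ 8)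
    (by simp [constantCoeff_euler])
  have ex : ∀ m, 0 < m → expand 4 four (euler m) = euler (4 * m) := fun m => expand_euler four
  change expand 4 four (F 0) * _ = _ at g0
  change expand 4 four (F 1) * _ = _ at g1
  change expand 4 four (F 2) * _ = _ at g2
  change expand 4 four (F 3) * _ = _ at g3
  norm_num only [map_mul, map_pow, map_ofNat, ex] at g0 g1 g2 g3
  have hn := phiNeg_mul_euler (show 0 < 4 by norm_num)
  have hp := phiPos_mul_euler (show 0 < 4 by norm_num)
  have hs := psi_mul_euler (show 0 < 8 by norm_num)
  norm_num only at hn hp hs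
  have E4 := euler_ne_zero (show 0 < 4 by norm_num)
  have E8 := euler_ne_zero (show 0 < 8 by norm_num)
  have E16 := euler_ne_zero (show 0 < 16 by norm_num)
  have c0 : expand 4 four (F 0) * phiNeg 4 ^ 4 = phiPos 4 ^ 3 := by
    refine mul_right_cancel₀ (mul_ne_zero (pow_ne_zero 4 E8)
      (mul_ne_zero (pow_ne_zero 6 E4) (pow_ne_zero 6 E16))) ?_
    calc _ = expand 4 four (F 0) * (phiNeg 4 * euler 8) ^ 4 * (euler 4 ^ 6 * euler 16 ^ 6) := by
          ring
      _ = expand 4 four (F 0) * (euler 4 ^ 14 * euler 16 ^ 6) := by rw [hn]; ring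
      _ = (phiPos 4 * (euler 4 ^ 2 * euler 16 ^ 2)) ^ 3 * euler 8 ^ 4 := by rw [g0, hp]; ring
      _ = _ := by ring
  have c1 : expand 4 four (F 1) * phiNeg 4 ^ 4 = 2 * (phiPos 4 ^ 2 * psi 8) := by
    refine mul_right_cancel₀ (mul_ne_zero (pow_ne_zero 5 E8)
      (mul_ne_zero (pow_ne_zero 4 E4) (pow_ne_zero 4 E16))) ?_
    calc _ = expand 4 four (F 1) * (phiNeg 4 * euler 8) ^ 4 *
          (euler 8 * euler 4 ^ 4 * euler 16 ^ 4) := by ring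
      _ = expand 4 four (F 1) * (euler 4 ^ 12 * euler 16 ^ 2) * (euler 8 * euler 16 ^ 2) := by
        rw [hn]; ring
      _ = 2 * (phiPos 4 * (euler 4 ^ 2 * euler 16 ^ 2)) ^ 2 * (psi 8 * euler 8) * euler 8 ^ 4 := by
        rw [g1, hp, hs]; ring
      _ = _ := by ring
  have c2 : expand 4 four (F 2) * phiNeg 4 ^ 4 = 4 * (phiPos 4 * psi 8 ^ 2) := by
    refine mul_right_cancel₀ (mul_ne_zero (pow_ne_zero 6 E8)
      (mul_ne_zero (pow_ne_zero 2 E4) (pow_ne_zero 2 E16))) ?_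
    calc _ = expand 4 four (F 2) * (phiNeg 4 * euler 8) ^ 4 *
          (euler 8 ^ 2 * euler 4 ^ 2 * euler 16 ^ 2) := by ring
      _ = expand 4 four (F 2) * euler 4 ^ 10 * (euler 8 ^ 2 * euler 16 ^ 2) := by
        rw [hn]; ring
      _ = 4 * (phiPos 4 * (euler 4 ^ 2 * euler 16 ^ 2)) * (psi 8 * euler 8) ^ 2 * euler 8 ^ 4 := by
        rw [g2, hp, hs]; ring
      _ = _ := by ring
  have c3 : expand 4 four (F 3) * phiNeg 4 ^ 4 = 8 * psi 8 ^ 3 := by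
    refine mul_right_cancel₀ (pow_ne_zero 7 E8) ?_
    calc _ = expand 4 four (F 3) * (phiNeg 4 * euler 8) ^ 4 * euler 8 ^ 3 := by ring
      _ = expand 4 four (F 3) * euler 4 ^ 8 * euler 8 ^ 3 := by rw [hn]; ring
      _ = 8 * (psi 8 * euler 8) ^ 3 * euler 8 ^ 4 := by rw [g3, hs]; ring
      _ = _ := by ring
  have h := genFun_eq_of_dissection four
    (pow_ne_zero 4 (phiNeg_ne_zero (show 0 < 4 by norm_num))) (F := F) (by
      rw [Fin.sum_univ_four, c0, c1, c2, c3, genFun_mul_phiNeg_four_pow, Fin.val_zero, Fin.val_one,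
        Fin.val_two, show ((3 : Fin 4) : ℕ) = 3 from rfl]
      ring)
  exact ⟨h 0, h 1, h 2, h 3⟩

end JaggedPartition

theorem proposition11 :
    genFun 2 0 = euler 4 ^ 5 * (euler 1 ^ 4 * euler 8 ^ 2)⁻¹ ∧
    genFun 2 1 = 2 * (euler 2 ^ 2 * euler 8 ^ 2) * (euler 1 ^ 4 * euler 4)⁻¹ ∧
    genFun 3 0 = euler 2 ^ 4 * euler 3 ^ 6 * (euler 1 ^ 8 * euler 6 ^ 3)⁻¹ ∧
    genFun 3 1 = 2 * (euler 2 ^ 3 * euler 3 ^ 3) * (euler 1 ^ 7)⁻¹ ∧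
    genFun 3 2 = 4 * (euler 2 ^ 2 * euler 6 ^ 3) * (euler 1 ^ 6)⁻¹ ∧
    genFun 4 0 = euler 2 ^ 19 * (euler 1 ^ 14 * euler 4 ^ 6)⁻¹ ∧
    genFun 4 1 = 2 * euler 2 ^ 13 * (euler 1 ^ 12 * euler 4 ^ 2)⁻¹ ∧
    genFun 4 2 = 4 * (euler 2 ^ 7 * euler 4 ^ 2) * (euler 1 ^ 10)⁻¹ ∧
    genFun 4 3 = 8 * (euler 2 * euler 4 ^ 6) * (euler 1 ^ 8)⁻¹ := by
  exact ⟨genFun_two_eq.1, genFun_two_eq.2, genFun_three_eq.1, genFun_three_eq.2.1,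
    genFun_three_eq.2.2, genFun_four_eq.1, genFun_four_eq.2.1, genFun_four_eq.2.2.1,
    genFun_four_eq.2.2.2⟩
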